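/- \textbf{Proposition (selection of $K$ in the popularity adjusted block model).} \emph{Setting.} For $c\in[K]^n$ write $n_k(c)=\#\{i: c(i)=k\}$, and call $c$ \emph{$C$-balanced} if $\frac{n}{CK}\le n_k(c)\le \frac{Cn}{K}$ for all $k\in[K]$. For $M\in\mathbb R^{n\times n}$ let $f(c,M)=\max_{k\in[K]}\sigma_2\big((M_{ij})_{i,j:\,c(i)=c(j)=k}\big)$, where $\sigma_2$ is the second largest singular value (and $0$ for matrices of size at most $1$). Fix constants $C_1\ge 1$, $C_2\ge 4C_1$, $c_0>0$, $\gamma>0$. For each $n$ let $K=K_n$ be a number of communities, $\rho_n\in(0,1]$, $\Lambda=(\lambda_{ik})=\rho_n\Lambda_0$ with $\Lambda_0\in(0,1)^{n\times K}$, $c^*\in[K]^n$ a $C_1$-balanced labelling, and $\Theta=(\theta_{ij})$ with $\theta_{ij}=\lambda_{i c^*(j)}\lambda_{j c^*(i)}$. Let $A$ be a random symmetric $\{0,1\}$-matrix with $A_{ii}=0$ whose entries $A_{ij}$, $i<j$, are independent with $A_{ij}\sim\mathrm{Bern}(\theta_{ij})$. For $\tilde K\ge 1$ let $c_{\tilde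 K}$ be a (non-random) minimizer of $f(\tilde c,\Theta)$ over all $C_2$-balanced $\tilde c\in[\tilde K]^n$. Assume that for all large $n$ and all $1\le \tilde K<K$, $$f(c_{\tilde K},\Theta)\ \ge\ c_0\,\frac{n\rho_n^2}{\tilde K\sqrt{\log n}}.$$ Then: (I) For every $n$ and every $\tilde K\ge K$, every such minimizer satisfies $f(c_{\tilde K},\Theta)=0$. (II) Let $K_{\max}=K_{\max,n}$ satisfy $K_{\max}\le n^{1-\gamma}$ for all large $n$ and $\rho_n^2\, n/K_{\max}\gg(\log n)^2$ (that is, $(\log n)^2=o(\rho_n^2 n/K_{\max})$), and for each $n$ and each $\tilde K\le K_{\max}$ fix a minimizer $c_{\tilde K}$. Then there are constants $a,b,C'>0$, depending only on $C_1,C_2,c_0,\gamma$, such that for all large $n$, with probability at least $1-n^{-C'}$, the following hold simultaneously for all $1\le\tilde K\le K_{\max}$: $$f(c_{\tilde K},A)\le b\,\rho_n\sqrt{\frac{n}{\tilde K}}\quad\text{if }\tilde K\ge K,\qquad a\,\frac{n\rho_n^2}{\tilde K\sqrt{\log n}}\le f(c_{\tilde K},A)\le b\,\frac{n\rho_n^2}{\tilde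 K}\quad\text{if }\tilde K<K .$$ -/

import Mathlib

open Filter Topology MeasureTheory ProbabilityTheory
open scoped Asymptotics

namespace PABM

/-- The edge probability matrix `θ i j = λ i (c j) * λ j (c i)` of the popularity adjusted block
model with popularity matrix `L` and community labels `c`. -/
def edgeProb {n K : ℕ} (L : Matrix (Fin n) (Fin K) ℝ) (c : Fin n → Fin K) :
    Matrix (Fin n) (Fin n) ℝ :=
  Matrix.of fun i j => L i (c j) * L j (c i)

/-- `A` is a random adjacency matrix of an undirected graph without self-loops whose edges
`i < j` are independent Bernoulli variables with success probabilities `Θ i j`. -/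
structure IsRandomAdjacency {Ω : Type*} [MeasurableSpace Ω] (P : Measure Ω) {n : ℕ}
    (Θ : Matrix (Fin n) (Fin n) ℝ) (A : Ω → Matrix (Fin n) (Fin n) ℝ) : Prop where
  measurable : ∀ i j, Measurable fun ω => A ω i j
  zero_or_one : ∀ ω i j, A ω i j = 0 ∨ A ω i j = 1
  symm : ∀ ω i j, A ω i j = A ω j i
  diag : ∀ ω i, A ω i i = 0
  prob : ∀ i j, i < j → P.real {ω | A ω i j = 1} = Θ i j
  indep : iIndepFun
    (fun (p : {p : Fin n × Fin n // p.1 < p.2}) (ω : Ω) => A ω p.1.1 p.1.2) P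

/-- The size of community `k` under the labelling `c`. -/
def communitySize {n K : ℕ} (c : Fin n → Fin K) (k : Fin K) : ℕ :=
  Fintype.card {i // c i = k}

/-- All `K` community sizes lie in `[n / (C K), C n / K]`. -/
def IsBalanced (C : ℝ) {n K : ℕ} (c : Fin n → Fin K) : Prop :=
  ∀ k, (n : ℝ) / (C * K) ≤ communitySize c k ∧ (communitySize c k : ℝ) ≤ C * n / K

/-- The diagonal block of `M` with rows and columns in community `k` of the labelling `c`. -/
def diagBlock {n K : ℕ} (c : Fin n → Fin K) (M : Matrix (Fin n) (Fin n) ℝ) (k : Fin K) :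
    Matrix {i // c i = k} {i // c i = k} ℝ :=
  M.submatrix Subtype.val Subtype.val

/-- The second largest singular value of a square real matrix (`0` if the size is at most `1`);
Mathlib's sequence of singular values is decreasing and indexed from `0`. -/
noncomputable def sigmaTwo {ι : Type*} [Fintype ι] [DecidableEq ι] (M : Matrix ι ι ℝ) : ℝ :=
  (Matrix.toEuclideanLin M).singularValues 1

/-- `f(c, M)`, the maximum over communities `k` of the second singular value of the `k`-th
diagonal block of `M`. -/
noncomputable def f {n K : ℕ} (c : Fin n → Fin K) (M : Matrix (Fin n) (Fin n) ℝ) : ℝ :=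
  ⨆ k, sigmaTwo (diagBlock c M k)

/-- `c` minimizes `f(·, Θ)` over all labellings whose community sizes are balanced with
constant `C`. -/
def IsOptimal (C : ℝ) {n K : ℕ} (Θ : Matrix (Fin n) (Fin n) ℝ) (c : Fin n → Fin K) : Prop :=
  IsBalanced C c ∧ ∀ c' : Fin n → Fin K, IsBalanced C c' → f c Θ ≤ f c' Θ

/-- The minimization problem has a solution whenever `1 ≤ K ≤ n` and `C ≥ 2`. -/
theorem exists_isOptimal {C : ℝ} (hC : 2 ≤ C) {n K : ℕ} (hK : 0 < K) (hKn : K ≤ n)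
    (Θ : Matrix (Fin n) (Fin n) ℝ) : ∃ c : Fin n → Fin K, IsOptimal C Θ c := by
  classical
  have hbal : ∃ c : Fin n → Fin K, IsBalanced C c := by
    refine ⟨fun i => ⟨i % K, Nat.mod_lt _ hK⟩, fun k => ?_⟩
    have hcard : communitySize (fun i : Fin n => (⟨i % K, Nat.mod_lt _ hK⟩ : Fin K)) k
        = n / K + if (k : ℕ) % K < n % K then 1 else 0 := by
      rw [← Nat.count_modEq_card n hK, Nat.count_eq_card_filter_range, communitySize,
        Fintype.card_subtype]
      refine Finset.card_bij (fun i _ => (i : ℕ)) ?_ ?_ ?_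
      · intro i hi
        simpa [Fin.ext_iff, Nat.ModEq, Nat.mod_eq_of_lt k.2] using hi
      · intro i _ j _ h
        exact Fin.ext h
      · intro m hm
        simp only [Finset.mem_filter, Finset.mem_range, Nat.ModEq, Nat.mod_eq_of_lt k.2] at hm
        exact ⟨⟨m, hm.1⟩, by simpa [Fin.ext_iff] using hm.2, rfl⟩
    rw [hcard]
    have h1 : 1 ≤ n / K := (Nat.one_le_div_iff hK).2 hKn
    have hdm := Nat.div_add_mod n K
    have hm := Nat.mod_lt n hK
    have hKR : (0 : ℝ) < K := by exact_mod_cast hK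
    have hlo : (n : ℝ) ≤ 2 * K * (n / K : ℕ) := by
      have : n ≤ 2 * K * (n / K) := by nlinarith
      exact_mod_cast this
    have hup : (K : ℝ) * (n / K : ℕ) ≤ n := by
      have : K * (n / K) ≤ n := by omega
      exact_mod_cast this
    have h1R : (1 : ℝ) ≤ (n / K : ℕ) := by exact_mod_cast h1
    have hite : (0 : ℝ) ≤ ((if (k : ℕ) % K < n % K then 1 else 0 : ℕ) : ℝ) ∧
        ((if (k : ℕ) % K < n % K then 1 else 0 : ℕ) : ℝ) ≤ 1 := by
      split_ifs <;> simp
    rw [Nat.cast_add]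
    generalize ((n / K : ℕ) : ℝ) = q at *
    generalize ((if (k : ℕ) % K < n % K then 1 else 0 : ℕ) : ℝ) = e at *
    have hCK : 2 * (K : ℝ) ≤ C * K := by nlinarith
    have hn0 : (0 : ℝ) ≤ n := Nat.cast_nonneg n
    constructor
    · rw [div_le_iff₀ (by positivity)]
      nlinarith
    · rw [le_div_iff₀ hKR]
      nlinarith
  obtain ⟨c, hc, hmin⟩ := Set.exists_min_image {c : Fin n → Fin K | IsBalanced C c}
    (fun c => f c Θ) (Set.toFinite _) hbal
  exact ⟨c, hc, hmin⟩

end PABM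

/-!
Why the theorem holds.

*More classes than communities.* A labelling that refines the true communities has diagonal blocks
of rank one, so that the criterion vanishes on it. Splitting each community into nearly equal parts
gives such a refinement with any number of classes between `K` and `n`; counting how many parts
each community needs shows that the refinement can be kept balanced at the cost of a factor `4` in
the constant (`IsBalanced.exists_refinement`, `IsOptimal.f_eq_zero`).

*Perturbation.* By Weyl's inequality for the second singular value, `f` is Lipschitz for the
operator norm of the diagonal blocks (`abs_f_sub_f_le`). Since the labellings do not depend on the
graph, it remains to bound the norm of finitely many centered adjacency matrices, and to compare
the noise `ρ √(n / T)` with the signal `n ρ² / (T √(log n))`; the assumption on `Kmax` makes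
`ρ √(n / T)` at least `log n` for large `n`.

*The noise.* The bound `‖X‖ ≤ C √(N p)` for a centered sparse adjacency matrix of size `N` and
density `p` must not lose a logarithm. It is obtained by comparing trace moments, in the manner of
Bandeira and van Handel. Expanding `E tr X ^ (2 q)` over closed walks, only walks that use each
edge at least twice contribute (`IsDoubledWalk`), and a walk with `m` vertices contributes at most
`p ^ (m - 1)`, as it has at least `m - 1` edges. Let `Y` be an `r × r` symmetric matrix whose
independent entries are `2` with probability `1/3` and `-1` with probability `2/3`: they are
centered, and all their higher moments are at least `1`, so that each such walk contributes at
least `1` to `E tr Y ^ (2 q)`. Counting walks by the partition of the times which they induce gives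
`E tr X ^ (2 q) ≤ (N / r) E tr Y ^ (2 q)` as soon as `N p ≤ r - q` (`sum_doubledWalks_le`). With
`r = 2 q` and `q` of the order of `N p`, the matrix `Y` is dense and its moments at the order of its
dimension follow from a sub-Gaussian bound on a net (`integral_trace_pow_comparison_le`). Markov's
inequality then gives failure probabilities exponentially small in `N p`
(`measureReal_norm_symMatrix_ge_le`), and since `N p` is at least of the order of `(log n) ^ 2`
there is room for a union bound over all blocks of all labellings.
-/

namespace PABM

/-! ### Second singular values under perturbation -/

section SingularValues

open Module InnerProductSpace

variable {E F : Type*} [NormedAddCommGroup E] [InnerProductSpace ℝ E] [FiniteDimensional ℝ E]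
  [NormedAddCommGroup F] [InnerProductSpace ℝ F] [FiniteDimensional ℝ F]

/-- The squared length of `T v` in an orthonormal eigenbasis of `T* T`. -/
lemma norm_sq_apply_eq_sum_singularValues (T : E →ₗ[ℝ] F) {n : ℕ} (hn : finrank ℝ E = n)
    (v : E) :
    ‖T v‖ ^ 2 = ∑ i : Fin n, T.singularValues i ^ 2 *
      ⟪T.isSymmetric_adjoint_comp_self.eigenvectorBasis hn i, v⟫_ℝ ^ 2 := by
  set u := T.isSymmetric_adjoint_comp_self.eigenvectorBasis hn with hu
  have h1 : ‖T v‖ ^ 2 = ⟪v, (T.adjoint ∘ₗ T) v⟫_ℝ := by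
    rw [LinearMap.comp_apply, LinearMap.adjoint_inner_right, real_inner_self_eq_norm_sq]
  rw [h1, ← u.sum_inner_mul_inner]
  refine Finset.sum_congr rfl fun i _ => ?_
  rw [← T.isSymmetric_adjoint_comp_self (u i) v, hu,
    T.isSymmetric_adjoint_comp_self.apply_eigenvectorBasis hn i, inner_smul_left,
    T.sq_singularValues_fin hn, real_inner_comm]
  simp
  ring

/-- Every hyperplane contains a unit vector on which `T` is at least as large as its second
singular value: intersect it with the span of the two leading right singular vectors. -/
lemma exists_unit_orthogonal_singularValues_le (T : E →ₗ[ℝ] F) (hE : 2 ≤ finrank ℝ E) (w : E) :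
    ∃ v : E, ‖v‖ = 1 ∧ ⟪w, v⟫_ℝ = 0 ∧ T.singularValues 1 ≤ ‖T v‖ := by
  obtain ⟨n, hn⟩ : ∃ n, finrank ℝ E = n := ⟨_, rfl⟩
  rw [hn] at hE
  set u := T.isSymmetric_adjoint_comp_self.eigenvectorBasis hn with hu
  set i₀ : Fin n := ⟨0, by omega⟩ with hi₀
  set i₁ : Fin n := ⟨1, by omega⟩ with hi₁
  have h01 : i₀ ≠ i₁ := by simp [hi₀, hi₁]
  -- a nontrivial solution `(s, t)` of the linear equation `⟪w, s u₀ + t u₁⟫ = 0`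
  obtain ⟨s, t, hst, hw⟩ : ∃ s t : ℝ, s ^ 2 + t ^ 2 = 1 ∧
      s * ⟪w, u i₀⟫_ℝ + t * ⟪w, u i₁⟫_ℝ = 0 := by
    set a := ⟪w, u i₀⟫_ℝ
    set b := ⟪w, u i₁⟫_ℝ
    rcases eq_or_ne (a ^ 2 + b ^ 2) 0 with h0 | h0
    · have ha : a = 0 := by nlinarith [sq_nonneg a, sq_nonneg b]
      have hb : b = 0 := by nlinarith [sq_nonneg a, sq_nonneg b]
      exact ⟨1, 0, by norm_num, by simp [ha, hb]⟩
    · have hpos : 0 < a ^ 2 + b ^ 2 := lt_of_le_of_ne (by positivity) h0.symm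
      refine ⟨b / √(a ^ 2 + b ^ 2), -a / √(a ^ 2 + b ^ 2), ?_, by ring⟩
      rw [div_pow, div_pow, Real.sq_sqrt hpos.le]
      field_simp
      ring
  set v := s • u i₀ + t • u i₁ with hv
  have hcoord : ∀ i, ⟪u i, v⟫_ℝ = (if i = i₀ then s else 0) + if i = i₁ then t else 0 := by
    intro i
    simp [hv, inner_add_right, inner_smul_right, orthonormal_iff_ite.mp u.orthonormal]
  have hnorm : ‖v‖ ^ 2 = 1 := by
    rw [← u.sum_sq_inner_right, ← hst,
      ← Finset.sum_subset (Finset.subset_univ {i₀, i₁}), Finset.sum_pair h01]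
    · simp [hcoord, h01, h01.symm]
    · intro i _ hi
      simp only [Finset.mem_insert, Finset.mem_singleton, not_or] at hi
      simp [hcoord, hi.1, hi.2]
  refine ⟨v, by rw [← sq_eq_sq₀ (norm_nonneg _) zero_le_one, hnorm, one_pow], ?_, ?_⟩
  · simpa [hv, inner_add_right, inner_smul_right] using hw
  · refine le_of_sq_le_sq ?_ (norm_nonneg _)
    rw [norm_sq_apply_eq_sum_singularValues T hn, ← hu,
      ← Finset.sum_subset (Finset.subset_univ {i₀, i₁}), Finset.sum_pair h01]
    · have h10 : T.singularValues 1 ^ 2 ≤ T.singularValues 0 ^ 2 :=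
        pow_le_pow_left₀ (T.singularValues_nonneg 1) (T.singularValues_antitone zero_le_one) 2
      simp only [hcoord, h01, h01.symm, if_true, if_false, add_zero, zero_add]
      change _ ≤ T.singularValues 0 ^ 2 * s ^ 2 + T.singularValues 1 ^ 2 * t ^ 2
      nlinarith [sq_nonneg s, mul_le_mul_of_nonneg_right h10 (sq_nonneg s)]
    · intro i _ hi
      simp only [Finset.mem_insert, Finset.mem_singleton, not_or] at hi
      simp [hcoord, hi.1, hi.2]

/-- On the hyperplane orthogonal to the leading right singular vector, `T` is bounded by its
second singular value. -/
lemma exists_norm_apply_le_singularValues_of_orthogonal (T : E →ₗ[ℝ] F)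
    (hE : 2 ≤ finrank ℝ E) :
    ∃ w : E, ∀ v : E, ⟪w, v⟫_ℝ = 0 → ‖T v‖ ≤ T.singularValues 1 * ‖v‖ := by
  obtain ⟨n, hn⟩ : ∃ n, finrank ℝ E = n := ⟨_, rfl⟩
  rw [hn] at hE
  set u := T.isSymmetric_adjoint_comp_self.eigenvectorBasis hn with hu
  refine ⟨u ⟨0, by omega⟩, fun v hv => le_of_sq_le_sq ?_ ?_⟩
  · rw [norm_sq_apply_eq_sum_singularValues T hn, mul_pow, ← u.sum_sq_inner_right v,
      Finset.mul_sum]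
    refine Finset.sum_le_sum fun i _ => ?_
    rcases Nat.eq_zero_or_pos i with h | h
    · have : i = ⟨0, by omega⟩ := Fin.ext h
      rw [this, ← hu, hv]
      simp
    · exact mul_le_mul_of_nonneg_right (pow_le_pow_left₀ (T.singularValues_nonneg _)
        (T.singularValues_antitone h) 2) (sq_nonneg _)
  · exact mul_nonneg (T.singularValues_nonneg _) (norm_nonneg _)

/-- Weyl's perturbation inequality for the second singular value. -/
lemma singularValues_one_le_add (S T : E →ₗ[ℝ] F) {δ : ℝ} (hδ : 0 ≤ δ)
    (h : ∀ v, ‖S v - T v‖ ≤ δ * ‖v‖) :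
    S.singularValues 1 ≤ T.singularValues 1 + δ := by
  rcases lt_or_ge (finrank ℝ E) 2 with hE | hE
  · rw [S.singularValues_of_finrank_le (by omega)]
    exact add_nonneg (T.singularValues_nonneg _) hδ
  · obtain ⟨w, hw⟩ := exists_norm_apply_le_singularValues_of_orthogonal T hE
    obtain ⟨v, hv1, hvw, hv⟩ := exists_unit_orthogonal_singularValues_le S hE w
    have h1 := hw v hvw
    have h2 := h v
    rw [hv1, mul_one] at h1 h2
    linarith [norm_le_insert' (S v) (T v)]

end SingularValues

/-! ### The criterion and its perturbation -/

section SigmaTwo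

open scoped Matrix.Norms.L2Operator

variable {ι : Type*} [Fintype ι] [DecidableEq ι]

lemma sigmaTwo_nonneg (M : Matrix ι ι ℝ) : 0 ≤ sigmaTwo M :=
  LinearMap.singularValues_nonneg _ _

lemma sigmaTwo_le_add_norm_sub (M N : Matrix ι ι ℝ) : sigmaTwo M ≤ sigmaTwo N + ‖M - N‖ := by
  refine singularValues_one_le_add _ _ (norm_nonneg _) fun v => ?_
  rw [← LinearMap.sub_apply, ← map_sub, ← Matrix.coe_toEuclideanCLM_eq_toEuclideanLin,
    ← Matrix.l2_opNorm_toEuclideanCLM]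
  exact ContinuousLinearMap.le_opNorm _ _

lemma sigmaTwo_le_norm (M : Matrix ι ι ℝ) : sigmaTwo M ≤ ‖M‖ := by
  have h := sigmaTwo_le_add_norm_sub M 0
  have h0 : sigmaTwo (0 : Matrix ι ι ℝ) = 0 := by simp [sigmaTwo]
  simpa [h0] using h

lemma sigmaTwo_eq_zero_of_eq_mul (M : Matrix ι ι ℝ) (u v : ι → ℝ) (h : ∀ i j, M i j = u i * v j) :
    sigmaTwo M = 0 := by
  rw [sigmaTwo, LinearMap.singularValues_eq_zero_iff_le_finrank_range]
  have hle : LinearMap.range (Matrix.toEuclideanLin M) ≤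
      Submodule.span ℝ {(WithLp.toLp 2 u : EuclideanSpace ℝ ι)} := by
    rintro _ ⟨x, rfl⟩
    rw [Submodule.mem_span_singleton]
    refine ⟨∑ j, v j * x j, ?_⟩
    ext i
    simp [Matrix.toLpLin_apply, Matrix.mulVec, dotProduct, h, Finset.mul_sum, mul_comm, mul_assoc]
  exact (Submodule.finrank_mono hle).trans ((finrank_span_le_card _).trans (by simp))

lemma f_le_of_forall {n K : ℕ} {c : Fin n → Fin K} {M : Matrix (Fin n) (Fin n) ℝ} {B : ℝ}
    (hB : 0 ≤ B) (h : ∀ k, sigmaTwo (diagBlock c M k) ≤ B) : f c M ≤ B :=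
  Real.iSup_le h hB

lemma sigmaTwo_le_f {n K : ℕ} (c : Fin n → Fin K) (M : Matrix (Fin n) (Fin n) ℝ) (k : Fin K) :
    sigmaTwo (diagBlock c M k) ≤ f c M :=
  le_ciSup (f := fun k => sigmaTwo (diagBlock c M k)) (Set.finite_range _).bddAbove k

lemma f_nonneg {n K : ℕ} (c : Fin n → Fin K) (M : Matrix (Fin n) (Fin n) ℝ) : 0 ≤ f c M :=
  Real.iSup_nonneg fun _ => sigmaTwo_nonneg _

/-- The criterion `f` is Lipschitz in the matrix for the operator norm of the diagonal blocks. -/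
lemma abs_f_sub_f_le {n K : ℕ} (c : Fin n → Fin K) (M N : Matrix (Fin n) (Fin n) ℝ) {δ : ℝ}
    (hδ : 0 ≤ δ) (h : ∀ k, ‖diagBlock c M k - diagBlock c N k‖ ≤ δ) : |f c M - f c N| ≤ δ := by
  have key : ∀ M N : Matrix (Fin n) (Fin n) ℝ,
      (∀ k, ‖diagBlock c M k - diagBlock c N k‖ ≤ δ) → f c M ≤ f c N + δ := fun M N h =>
    f_le_of_forall (add_nonneg (f_nonneg _ _) hδ) fun k =>
      (sigmaTwo_le_add_norm_sub _ _).trans (add_le_add (sigmaTwo_le_f c N k) (h k))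
  have h1 := key M N h
  have h2 := key N M fun k => by rw [norm_sub_rev]; exact h k
  rw [abs_le]
  constructor <;> linarith

end SigmaTwo

/-! ### Balanced refinements of a labelling -/

section Refinement

/-- A finite type splits into `m` classes as even as possible, hence with sizes in `[t, s]` as
soon as `m * t` and `m * s` bracket its cardinality. -/
lemma exists_map_card_fiber_mem_Icc {α : Type*} [Fintype α] {m s t : ℕ} (hm : 0 < m)
    (ht : m * t ≤ Fintype.card α) (hs : Fintype.card α ≤ m * s) :
    ∃ g : α → Fin m, ∀ k, t ≤ Fintype.card {a // g a = k} ∧ Fintype.card {a // g a = k} ≤ s := by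
  classical
  set N := Fintype.card α with hN
  refine ⟨fun a => ⟨(Fintype.equivFin α a : ℕ) % m, Nat.mod_lt _ hm⟩, fun k => ?_⟩
  have hcard : Fintype.card {a : α // (⟨(Fintype.equivFin α a : ℕ) % m, Nat.mod_lt _ hm⟩ : Fin m)
      = k} = N / m + if (k : ℕ) % m < N % m then 1 else 0 := by
    rw [← Nat.count_modEq_card N hm, Nat.count_eq_card_filter_range, Fintype.card_subtype]
    refine Finset.card_bij (fun a _ => (Fintype.equivFin α a : ℕ)) ?_ ?_ ?_
    · intro i hi
      simpa [Fin.ext_iff, Nat.ModEq, Nat.mod_eq_of_lt k.2, hN] using hi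
    · intro i _ j _ h
      exact (Fintype.equivFin α).injective (Fin.ext h)
    · intro l hl
      simp only [Finset.mem_filter, Finset.mem_range, Nat.ModEq, Nat.mod_eq_of_lt k.2] at hl
      exact ⟨(Fintype.equivFin α).symm ⟨l, hl.1⟩, by simpa [Fin.ext_iff] using hl.2, by simp⟩
  rw [hcard]
  have hdm := Nat.div_add_mod N m
  have hlo : t ≤ N / m := (Nat.le_div_iff_mul_le hm).2 (by rwa [mul_comm])
  refine ⟨by omega, ?_⟩
  split_ifs with h
  · have : N / m < s := by
      rw [Nat.div_lt_iff_lt_mul hm, mul_comm]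
      rcases hs.lt_or_eq with h' | h'
      · exact h'
      · rw [h', Nat.mul_mod_right] at h
        omega
    omega
  · have : N / m ≤ s := by
      calc N / m ≤ m * s / m := Nat.div_le_div_right hs
        _ = s := Nat.mul_div_cancel_left s hm
    omega

/-- Discrete intermediate values for integer vectors between `lo` and `hi`. -/
lemma exists_between_sum_eq {κ : Type*} [Fintype κ] (lo hi : κ → ℕ) (hle : ∀ k, lo k ≤ hi k)
    (T : ℕ) (h1 : ∑ k, lo k ≤ T) (h2 : T ≤ ∑ k, hi k) :
    ∃ m : κ → ℕ, (∀ k, lo k ≤ m k ∧ m k ≤ hi k) ∧ ∑ k, m k = T := by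
  classical
  induction T, h1 using Nat.le_induction with
  | base => exact ⟨lo, fun k => ⟨le_rfl, hle k⟩, rfl⟩
  | succ T _ ih =>
    obtain ⟨m, hm, hsum⟩ := ih (by omega)
    obtain ⟨k, -, hk⟩ : ∃ k ∈ Finset.univ, m k < hi k := by
      refine Finset.exists_lt_of_sum_lt ?_
      omega
    refine ⟨Function.update m k (m k + 1), fun j => ?_, ?_⟩
    · rcases eq_or_ne j k with rfl | hj
      · simp only [Function.update_self]
        exact ⟨(hm j).1.trans (Nat.le_succ _), hk⟩
      · simpa [Function.update_of_ne hj] using hm j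
    · rw [Finset.sum_update_of_mem (Finset.mem_univ k), ← hsum,
        ← Finset.add_sum_erase _ _ (Finset.mem_univ k), Finset.sdiff_singleton_eq_erase]
      ring

/-- If the number `T` of classes fits, a labelling can be refined to `T` classes with sizes
in `[t, s]`. -/
lemma exists_refinement {n K : ℕ} (c : Fin n → Fin K) {s t T : ℕ} (lo hi : Fin K → ℕ)
    (hlo : ∀ k, 0 < lo k) (hle : ∀ k, lo k ≤ hi k) (hs : ∀ k, communitySize c k ≤ lo k * s)
    (ht : ∀ k, hi k * t ≤ communitySize c k) (h1 : ∑ k, lo k ≤ T) (h2 : T ≤ ∑ k, hi k) :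
    ∃ c' : Fin n → Fin T, (∀ i j, c' i = c' j → c i = c j) ∧
      ∀ k, t ≤ communitySize c' k ∧ communitySize c' k ≤ s := by
  classical
  obtain ⟨m, hm, hsum⟩ := exists_between_sum_eq lo hi hle T h1 h2
  have hg : ∀ k, ∃ g : {i // c i = k} → Fin (m k), ∀ l,
      t ≤ Fintype.card {a // g a = l} ∧ Fintype.card {a // g a = l} ≤ s := fun k =>
    exists_map_card_fiber_mem_Icc ((hlo k).trans_le (hm k).1)
      ((Nat.mul_le_mul_right _ (hm k).2).trans (ht k))
      ((hs k).trans (Nat.mul_le_mul_right _ (hm k).1))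
  choose g hg using hg
  have e : (Σ k, Fin (m k)) ≃ Fin T := Fintype.equivFinOfCardEq (by simp [hsum])
  refine ⟨fun i => e ⟨c i, g (c i) ⟨i, rfl⟩⟩, fun i j h => ?_, fun k => ?_⟩
  · exact congrArg Sigma.fst (e.injective h)
  · obtain ⟨⟨k, l⟩, rfl⟩ := e.surjective k
    have : communitySize (fun i => e ⟨c i, g (c i) ⟨i, rfl⟩⟩) (e ⟨k, l⟩) =
        Fintype.card {a // g k a = l} := by
      refine Fintype.card_congr ⟨fun i => ⟨⟨i.1, ?_⟩, ?_⟩, fun a => ⟨a.1.1, ?_⟩, ?_, ?_⟩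
      · exact congrArg Sigma.fst (e.injective i.2)
      · obtain ⟨i, hi⟩ := i
        have h := e.injective hi
        obtain rfl : c i = k := congrArg Sigma.fst h
        exact eq_of_heq (Sigma.mk.inj h).2
      · obtain ⟨⟨i, rfl⟩, rfl⟩ := a
        rfl
      · intro i
        rfl
      · intro a
        rfl
    rw [this]
    exact hg k l

lemma sum_communitySize {n K : ℕ} (c : Fin n → Fin K) : ∑ k, communitySize c k = n := by
  simp only [communitySize]
  rw [← Fintype.card_sigma, Fintype.card_congr (Equiv.sigmaFiberEquiv c), Fintype.card_fin]

/-- A balanced labelling with `K` classes has, for every `T` between `K` and `n`, a refinement to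
`T` classes which is balanced up to a factor `4` in the constant. -/
lemma IsBalanced.exists_refinement {C C' : ℝ} (hC : 1 ≤ C) (hC' : 4 * C ≤ C') {n K T : ℕ}
    {c : Fin n → Fin K} (hc : IsBalanced C c) (hn : 0 < n) (hKT : K ≤ T) (hTn : T ≤ n) :
    ∃ c' : Fin n → Fin T, (∀ i j, c' i = c' j → c i = c j) ∧ IsBalanced C' c' := by
  have hK : 0 < K := (Nat.zero_le _).trans_lt (c ⟨0, hn⟩).2
  have hT : 0 < T := hK.trans_le hKT
  have hKR : (0 : ℝ) < K := by exact_mod_cast hK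
  have hTR : (0 : ℝ) < T := by exact_mod_cast hT
  have hnR : (0 : ℝ) < n := by exact_mod_cast hn
  have hKTR : (K : ℝ) ≤ T := by exact_mod_cast hKT
  -- the target size `r` of a class
  obtain ⟨r, hr⟩ : ∃ r : ℝ, r = n / T := ⟨_, rfl⟩
  have hr1 : 1 ≤ r := by
    rw [hr, one_le_div hTR]
    exact_mod_cast hTn
  have hrT : r * T = n := by rw [hr, div_mul_cancel₀ _ hTR.ne']
  have hCr : 1 ≤ C * r := one_le_mul_of_one_le_of_one_le hC hr1
  have hC0 : 0 < C := by linarith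
  obtain ⟨s, hs⟩ : ∃ s : ℕ, s = ⌊4 * C * r⌋₊ := ⟨_, rfl⟩
  obtain ⟨t, ht⟩ : ∃ t : ℕ, t = ⌈r / (4 * C)⌉₊ := ⟨_, rfl⟩
  have hs_le : (s : ℝ) ≤ 4 * C * r := hs ▸ Nat.floor_le (by nlinarith)
  have hs_ge : 3 * (C * r) ≤ s := by
    have := Nat.lt_floor_add_one (4 * C * r)
    rw [← hs] at this
    nlinarith
  have ht_ge : r / (4 * C) ≤ t := ht ▸ Nat.le_ceil _
  have ht0 : 0 < t := ht ▸ Nat.ceil_pos.2 (by positivity)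
  have hs3 : 3 ≤ s := by
    have : (3 : ℝ) ≤ s := by nlinarith
    exact_mod_cast this
  -- `t = 1` unless `r` is large, in which case rounding up costs at most a factor `2`
  have ht_or : t = 1 ∨ (t : ℝ) ≤ r / (2 * C) := by
    rcases le_or_gt r (4 * C) with h | h
    · left
      have : t ≤ 1 := ht ▸ Nat.ceil_le.2 (by
        rw [Nat.cast_one, div_le_one (by positivity)]
        exact h)
      omega
    · right
      have h1 : (t : ℝ) < r / (4 * C) + 1 := ht ▸ Nat.ceil_lt_add_one (by positivity)
      have h2 : 1 ≤ r / (4 * C) := by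
        rw [one_le_div (by positivity)]
        exact h.le
      have h3 : r / (2 * C) = 2 * (r / (4 * C)) := by
        field_simp
        norm_num
      linarith
  have hN_ge : ∀ k, r / C * (T / K) ≤ communitySize c k := fun k => by
    have := (hc k).1
    have e : r / C * (T / K) = (n : ℝ) / (C * K) := by
      rw [hr]
      field_simp
    rwa [e]
  have hTK : 1 ≤ (T : ℝ) / K := (one_le_div hKR).2 hKTR
  have hN_pos : ∀ k, 0 < communitySize c k := fun k => by
    have : (0 : ℝ) < communitySize c k := lt_of_lt_of_le (by positivity) (hN_ge k)
    exact_mod_cast this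
  have ht_le : ∀ k, t ≤ communitySize c k := fun k => by
    rcases ht_or with h | h
    · rw [h]
      exact hN_pos k
    · have h1 : r / (2 * C) ≤ r / C := by gcongr; linarith
      have h2 : r / C ≤ r / C * (T / K) := le_mul_of_one_le_right (by positivity) hTK
      have : (t : ℝ) ≤ communitySize c k := by linarith [hN_ge k]
      exact_mod_cast this
  have ht2s : t = 1 ∨ 2 * t ≤ s := by
    rcases ht_or with h | h
    · exact Or.inl h
    · have h1 : r / (2 * C) ≤ C * r / 2 := by
        rw [div_le_div_iff₀ (by positivity) (by positivity)]
        nlinarith [mul_le_mul hC hC zero_le_one hC0.le]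
      have : ((2 * t : ℕ) : ℝ) ≤ (s : ℝ) := by push_cast; linarith
      exact Or.inr (by exact_mod_cast this)
  -- community `k` is cut into between `⌈N k / s⌉` and `⌊N k / t⌋` parts, `N k` being its size; it
  -- remains to see that these bounds are compatible and that their sums enclose `T`
  obtain ⟨c', hc'1, hc'2⟩ := PABM.exists_refinement c (s := s) (t := t) (T := T)
    (fun k => (communitySize c k + s - 1) / s) (fun k => communitySize c k / t)
    (fun k => Nat.div_pos (by have := hN_pos k; omega) (by omega))
    (fun k => by
      rw [Nat.le_div_iff_mul_le ht0]
      have hNk := hN_pos k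
      have htk := ht_le k
      set N := communitySize c k
      have hq := Nat.div_mul_le_self (N + s - 1) s
      set q := (N + s - 1) / s
      rcases Nat.lt_or_ge q 2 with h | h
      · interval_cases q <;> omega
      · obtain ⟨p, hp⟩ : ∃ p, q = p + 1 := ⟨q - 1, by omega⟩
        rw [hp] at hq h ⊢
        have h1 : p * s ≤ N - 1 := by rw [add_mul] at hq; omega
        rcases ht2s with h2 | h2
        · have h3 : p * 1 ≤ p * s := Nat.mul_le_mul_left _ (by omega)
          rw [h2]
          omega
        · have h3 : (p + 1) * (2 * t) ≤ (p + 1) * s := Nat.mul_le_mul_left _ h2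
          have h4 : 1 * s ≤ p * s := Nat.mul_le_mul_right _ (by omega)
          have h5 : (p + 1) * (2 * t) = 2 * ((p + 1) * t) := by ring
          have h6 : (p + 1) * s = p * s + s := by ring
          rw [h5, h6] at h3
          omega)
    (fun k => by
      have := Nat.div_add_mod (communitySize c k + s - 1) s
      have := Nat.mod_lt (communitySize c k + s - 1) (show 0 < s by omega)
      rw [mul_comm]
      omega)
    (fun k => Nat.div_mul_le_self _ _)
    (by
      -- if `T` is much larger than `K`, rounding up costs at most `K` parts; otherwise every
      -- community has at most `s` elements and `⌈N k / s⌉ = 1`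
      rcases le_or_gt (3 * K) (2 * T) with h | h
      · have h1 : ∀ k, (((communitySize c k + s - 1) / s : ℕ) : ℝ) ≤ communitySize c k / s + 1 := by
          intro k
          have hsR : (0 : ℝ) < s := by positivity
          rw [div_add_one hsR.ne', le_div_iff₀ hsR]
          have := Nat.div_mul_le_self (communitySize c k + s - 1) s
          exact_mod_cast (show _ ≤ communitySize c k + s by omega)
        have h2 : (n : ℝ) / s ≤ T / 3 := by
          rw [div_le_div_iff₀ (by positivity) (by norm_num), ← hrT]
          nlinarith [mul_le_mul_of_nonneg_right hC (by positivity : (0 : ℝ) ≤ r * T),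
            mul_le_mul_of_nonneg_left hs_ge hTR.le]
        have h3 : (3 * K : ℝ) ≤ 2 * T := by exact_mod_cast h
        have h4 : ((∑ k, (communitySize c k + s - 1) / s : ℕ) : ℝ) ≤ T := by
          push_cast [Nat.cast_sum]
          calc ∑ k, (((communitySize c k + s - 1) / s : ℕ) : ℝ)
              ≤ ∑ k, ((communitySize c k : ℝ) / s + 1) := Finset.sum_le_sum fun k _ => h1 k
            _ = n / s + K := by
              rw [Finset.sum_add_distrib, ← Finset.sum_div, ← Nat.cast_sum, sum_communitySize]
              simp
            _ ≤ T := by linarith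
        exact_mod_cast h4
      · have h1 : ∀ k, (communitySize c k + s - 1) / s ≤ 1 := fun k => by
          have h2 : (2 * T : ℝ) < 3 * K := by exact_mod_cast h
          have h3 : (communitySize c k : ℝ) ≤ s := by
            refine (hc k).2.trans (le_trans ?_ hs_ge)
            rw [div_le_iff₀ hKR, ← hrT]
            nlinarith [mul_lt_mul_of_pos_left h2 (by positivity : 0 < C * r)]
          have h4 : communitySize c k ≤ s := by exact_mod_cast h3
          rw [Nat.div_le_iff_le_mul_add_pred (by omega)]
          omega
        calc _ ≤ ∑ _k : Fin K, 1 := Finset.sum_le_sum fun k _ => h1 k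
          _ ≤ T := by simpa using hKT)
    (by
      -- if `t > 1`, then `N k / t ≥ 2 T / K`, and rounding down loses at most half of it
      rcases ht_or with h | h
      · simpa [h, sum_communitySize] using hTn
      · have h1 : ∀ k, (T : ℝ) / K ≤ ((communitySize c k / t : ℕ) : ℝ) := fun k => by
          have htR : (0 : ℝ) < t := by exact_mod_cast ht0
          have h2 : 2 * ((T : ℝ) / K) ≤ communitySize c k / t := by
            rw [le_div_iff₀ htR]
            refine le_trans ?_ (hN_ge k)
            calc 2 * ((T : ℝ) / K) * t ≤ 2 * ((T : ℝ) / K) * (r / (2 * C)) := by gcongr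
              _ = r / C * (T / K) := by field_simp
          have h3 := Nat.lt_floor_add_one ((communitySize c k : ℝ) / t)
          rw [Nat.floor_div_eq_div] at h3
          linarith
        have h4 : (T : ℝ) ≤ ((∑ k, communitySize c k / t : ℕ) : ℝ) := by
          rw [Nat.cast_sum]
          calc (T : ℝ) = ∑ _k : Fin K, (T : ℝ) / K := by
                simp [mul_div_cancel₀ _ hKR.ne']
            _ ≤ _ := Finset.sum_le_sum fun k _ => h1 k
        exact_mod_cast h4)
  refine ⟨c', hc'1, fun k => ⟨?_, ?_⟩⟩
  · calc (n : ℝ) / (C' * T) = r / C' := by rw [hr, div_div, mul_comm]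
      _ ≤ r / (4 * C) := by gcongr
      _ ≤ t := ht_ge
      _ ≤ communitySize c' k := by exact_mod_cast (hc'2 k).1
  · calc (communitySize c' k : ℝ) ≤ s := by exact_mod_cast (hc'2 k).2
      _ ≤ 4 * C * r := hs_le
      _ ≤ C' * r := by gcongr
      _ = C' * n / T := by rw [hr, mul_div_assoc]

end Refinement

lemma edgeProb_eq_mul {n K : ℕ} (L : Matrix (Fin n) (Fin K) ℝ) (c : Fin n → Fin K)
    {i j : Fin n} (h : c i = c j) : edgeProb L c i j = L i (c i) * L j (c j) := by
  simp [edgeProb, h]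

/-- A labelling which refines the true communities has rank one diagonal blocks. -/
lemma f_edgeProb_eq_zero_of_refines {n K T : ℕ} (L : Matrix (Fin n) (Fin K) ℝ)
    (c : Fin n → Fin K) (c' : Fin n → Fin T) (h : ∀ i j, c' i = c' j → c i = c j) :
    f c' (edgeProb L c) = 0 := by
  refine le_antisymm (f_le_of_forall le_rfl fun k => le_of_eq ?_) (f_nonneg _ _)
  exact sigmaTwo_eq_zero_of_eq_mul _ (fun i => L i.1 (c i.1)) (fun i => L i.1 (c i.1))
    fun i j => edgeProb_eq_mul L c (h _ _ (i.2.trans j.2.symm))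

/-- With at least as many classes as there are communities, the optimal value is zero. -/
lemma IsOptimal.f_eq_zero {C C' : ℝ} (hC : 1 ≤ C) (hC' : 4 * C ≤ C') {n K T : ℕ} (hT : 0 < T)
    (hKT : K ≤ T) {L : Matrix (Fin n) (Fin K) ℝ} {cstar : Fin n → Fin K}
    (hstar : IsBalanced C cstar) {c : Fin n → Fin T} (hc : IsOptimal C' (edgeProb L cstar) c) :
    f c (edgeProb L cstar) = 0 := by
  rcases Nat.eq_zero_or_pos n with rfl | hn
  · exact f_edgeProb_eq_zero_of_refines _ _ _ fun i => i.elim0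
  · -- a balanced labelling has no empty class, so that `T ≤ n`
    have hpos : ∀ k, 1 ≤ communitySize c k := fun k => by
      have h0 : (0 : ℝ) < n / (C' * T) := by
        have : 0 < C' := by linarith
        have : (0 : ℝ) < n := by exact_mod_cast hn
        have : (0 : ℝ) < T := by exact_mod_cast hT
        positivity
      have : (0 : ℝ) < communitySize c k := h0.trans_le (hc.1 k).1
      exact_mod_cast this
    have hTn : T ≤ n := by
      calc T = ∑ _k : Fin T, 1 := by simp
        _ ≤ ∑ k, communitySize c k := Finset.sum_le_sum fun k _ => hpos k
        _ = n := sum_communitySize c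
    obtain ⟨c', h1, h2⟩ := hstar.exists_refinement hC hC' hn hKT hTn
    exact le_antisymm ((hc.2 c' h2).trans_eq (f_edgeProb_eq_zero_of_refines _ _ _ h1))
      (f_nonneg _ _)

/-! ### Closed walks with doubled edges -/

section Walks

variable {ι κ : Type*} {l : ℕ}

/-- The undirected edge traversed by the walk `w` at time `t`. -/
def walkEdge (w : Fin (l + 1) → ι) (t : Fin l) : Sym2 ι := s(w t.castSucc, w t.succ)

/-- A closed walk without loops which traverses each of its edges at least twice. -/
def IsDoubledWalk (w : Fin (l + 1) → ι) : Prop :=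
  w 0 = w (Fin.last l) ∧ (∀ t : Fin l, w t.castSucc ≠ w t.succ) ∧
    ∀ t, ∃ t', t' ≠ t ∧ walkEdge w t' = walkEdge w t

/-- The number of distinct vertices of a walk, as the number of classes of its kernel. -/
noncomputable def vertexCount (w : Fin (l + 1) → ι) : ℕ := Nat.card (Quotient (Setoid.ker w))

lemma isDoubledWalk_comp_iff {g : ι → κ} (hg : Function.Injective g) (w : Fin (l + 1) → ι) :
    IsDoubledWalk (g ∘ w) ↔ IsDoubledWalk w := by
  have h : ∀ t, walkEdge (g ∘ w) t = Sym2.map g (walkEdge w t) := fun t => by simp [walkEdge]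
  simp only [IsDoubledWalk, h, (Sym2.map.injective hg).eq_iff, Function.comp_apply, hg.eq_iff,
    hg.ne_iff]

/-- Whether a walk is doubled depends only on which of its vertices coincide. -/
lemma isDoubledWalk_iff_ker (w : Fin (l + 1) → ι) :
    IsDoubledWalk w ↔
      IsDoubledWalk (fun t => (Quotient.mk (Setoid.ker w) t : Quotient (Setoid.ker w))) :=
  isDoubledWalk_comp_iff (Setoid.kerLift_injective w)
    (fun t => (Quotient.mk (Setoid.ker w) t : Quotient (Setoid.ker w)))

lemma vertexCount_eq_card_image [DecidableEq ι] (w : Fin (l + 1) → ι) :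
    vertexCount w = (Finset.univ.image w).card := by
  rw [vertexCount, Nat.card_congr (Setoid.quotientKerEquivRange w), Nat.card_coe_set_eq,
    Set.ncard_eq_toFinset_card', Set.toFinset_range]

/-- Every vertex other than the starting point is entered for the first time along an edge of its
own. -/
lemma vertexCount_le_card_edges [DecidableEq ι] (w : Fin (l + 1) → ι) :
    vertexCount w ≤ (Finset.univ.image (walkEdge w)).card + 1 := by
  classical
  have hfirst : ∀ v ∈ (Finset.univ.image w).erase (w 0), ∃ t : Fin l, w t.succ = v ∧
      ∀ t' : Fin (l + 1), t' ≤ t.castSucc → w t' ≠ v := by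
    intro v hv
    simp only [Finset.mem_erase, Finset.mem_image, Finset.mem_univ, true_and] at hv
    obtain ⟨hv0, hv⟩ := hv
    obtain ⟨t, ht, hmin⟩ := WellFounded.has_min (wellFounded_lt (α := Fin (l + 1)))
      {t | w t = v} hv
    have ht0 : t ≠ 0 := by
      rintro rfl
      exact hv0 ht.symm
    obtain ⟨t, rfl⟩ := Fin.exists_succ_eq.2 ht0
    exact ⟨t, ht, fun t' ht' h => hmin t' h (ht'.trans_lt Fin.castSucc_lt_succ)⟩
  have hcard : ((Finset.univ.image w).erase (w 0)).card ≤
      (Finset.univ.image (walkEdge w)).card := by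
    rcases isEmpty_or_nonempty (Fin l) with hl | hl
    · rw [Finset.eq_empty_of_forall_notMem fun v hv => hl.elim (hfirst v hv).choose]
      simp
    choose! τ hτ using hfirst
    refine Finset.card_le_card_of_injOn (fun v => walkEdge w (τ v))
      (fun v _ => Finset.mem_image_of_mem _ (Finset.mem_univ _)) ?_
    intro v hv v' hv' h
    by_contra hne
    have h1 := hτ v hv
    have h2 := hτ v' hv'
    simp only [walkEdge, h1.1, h2.1, Sym2.eq_iff] at h
    rcases h with h | h
    · exact hne h.2
    · -- each of the two vertices would have been visited before the other
      have h3 : ¬ (τ v).castSucc ≤ (τ v').castSucc := fun hle => h2.2 _ hle h.1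
      have h4 : ¬ (τ v').castSucc ≤ (τ v).castSucc := fun hle => h1.2 _ hle h.2.symm
      exact h3 (le_of_not_ge h4)
  rw [Finset.card_erase_of_mem (Finset.mem_image_of_mem _ (Finset.mem_univ _))] at hcard
  rw [vertexCount_eq_card_image]
  omega

lemma IsDoubledWalk.two_mul_card_edges_le [DecidableEq ι] {w : Fin (l + 1) → ι}
    (hw : IsDoubledWalk w) : 2 * (Finset.univ.image (walkEdge w)).card ≤ l := by
  have h := Finset.mul_card_image_le_card (f := walkEdge w) (Finset.univ : Finset (Fin l)) 2 (by
    intro e he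
    obtain ⟨t, -, rfl⟩ := Finset.mem_image.1 he
    obtain ⟨t', hne, ht'⟩ := hw.2.2 t
    refine Finset.one_lt_card.2 ⟨t', by simpa using ht', t, by simp, hne⟩)
  simpa using h

lemma IsDoubledWalk.two_mul_vertexCount_le {w : Fin (l + 1) → ι}
    (hw : IsDoubledWalk w) : 2 * vertexCount w ≤ l + 2 := by
  classical
  have h1 := vertexCount_le_card_edges w
  have h2 := hw.two_mul_card_edges_le
  omega

/-- Summation over functions, organized by their kernels: a partition of the domain into `m`
classes is the kernel of `(card β) (card β - 1) ⋯ (card β - m + 1)` functions. -/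
lemma sum_ker_eq_sum_descFactorial {α β : Type*} [Fintype α] [Fintype β] [DecidableEq α]
    [Fintype (Setoid α)] (F : Setoid α → ℝ) :
    ∑ w : α → β, F (Setoid.ker w) =
      ∑ s : Setoid α, ((Fintype.card β).descFactorial (Nat.card (Quotient s)) : ℝ) * F s := by
  classical
  rw [← Finset.sum_fiberwise (s := Finset.univ) (g := fun w : α → β => Setoid.ker w)]
  refine Finset.sum_congr rfl fun s _ => ?_
  rw [Finset.sum_congr rfl (g := fun _ => F s) fun w hw => by rw [(Finset.mem_filter.1 hw).2],
    Finset.sum_const, nsmul_eq_mul]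
  congr 2
  have e : {w : α → β // Setoid.ker w = s} ≃ (Quotient s ↪ β) :=
    { toFun := fun w => ⟨Quotient.lift w.1 fun a b h => by
          rw [← w.2] at h
          exact h, by
          rintro ⟨a⟩ ⟨b⟩ h
          refine Quotient.sound ?_
          rw [← w.2]
          exact h⟩
      invFun := fun φ => ⟨fun a => φ (Quotient.mk s a), by
          ext a b
          exact (φ.injective.eq_iff).trans Quotient.eq⟩
      left_inv := fun w => rfl
      right_inv := fun φ => by
        ext x
        obtain ⟨a, rfl⟩ := Quotient.exists_rep x
        rfl }
  rw [← Fintype.card_subtype, Fintype.card_congr e, Fintype.card_embedding_eq,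
    Nat.card_eq_fintype_card]

open Classical in
/-- Comparison of doubled walks on two vertex sets. A pattern with `m` vertices has at most
`N ^ m` realizations in a set of size `N`, and at least `r (r - q) ^ (m - 1)` in a set of size
`r`; since `m ≤ q + 1` for walks of length `2 q`, a weight `p ^ (m - 1)` with `N p ≤ r - q`
compensates for a larger `N`. -/
lemma sum_doubledWalks_le {ι : Type*} [Fintype ι] {q r : ℕ} {p : ℝ} (hp : 0 ≤ p)
    (hqr : q < r) (hpr : Fintype.card ι * p ≤ r - q) :
    ∑ w : Fin (2 * q + 1) → ι, (if IsDoubledWalk w then p ^ (vertexCount w - 1) else 0) ≤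
      (Fintype.card ι : ℝ) / r *
        ∑ w : Fin (2 * q + 1) → Fin r, (if IsDoubledWalk w then (1 : ℝ) else 0) := by
  let : Fintype (Setoid (Fin (2 * q + 1))) :=
    @Fintype.ofFinite _ (Finite.of_injective (fun s : Setoid (Fin (2 * q + 1)) => s.r)
      fun s s' h => Setoid.ext fun a b => by rw [show s a b = s' a b from congrFun₂ h a b])
  let D : Setoid (Fin (2 * q + 1)) → Prop := fun s =>
    IsDoubledWalk (fun t => (Quotient.mk s t : Quotient s))
  have h1 : ∀ w : Fin (2 * q + 1) → ι, (if IsDoubledWalk w then p ^ (vertexCount w - 1) else 0) =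
      (fun s : Setoid (Fin (2 * q + 1)) =>
        if D s then p ^ (Nat.card (Quotient s) - 1) else 0) (Setoid.ker w) := fun w => by
    simp only [isDoubledWalk_iff_ker w, vertexCount, D]
  have h2 : ∀ w : Fin (2 * q + 1) → Fin r, (if IsDoubledWalk w then (1 : ℝ) else 0) =
      (fun s : Setoid (Fin (2 * q + 1)) => if D s then (1 : ℝ) else 0) (Setoid.ker w) :=
    fun w => by simp only [isDoubledWalk_iff_ker w, D]
  rw [Finset.sum_congr rfl fun w _ => h1 w, Finset.sum_congr rfl fun w _ => h2 w,
    sum_ker_eq_sum_descFactorial (fun s => if D s then p ^ (Nat.card (Quotient s) - 1) else 0),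
    sum_ker_eq_sum_descFactorial (fun s => if D s then (1 : ℝ) else 0), Finset.mul_sum]
  refine Finset.sum_le_sum fun s _ => ?_
  split_ifs with hs
  · set N := Fintype.card ι
    have hm1 : 1 ≤ Nat.card (Quotient s) := Nat.card_pos_iff.2 ⟨⟨⟦0⟧⟩, inferInstance⟩
    have hm2 : 2 * Nat.card (Quotient s) ≤ 2 * q + 2 := by
      have h := IsDoubledWalk.two_mul_vertexCount_le hs
      rwa [vertexCount, show Setoid.ker (fun t => (Quotient.mk s t : Quotient s)) = s from
        Setoid.ker_mk_eq s] at h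
    obtain ⟨m, hm⟩ : ∃ m, Nat.card (Quotient s) = m + 1 := ⟨_, (Nat.sub_add_cancel hm1).symm⟩
    rw [hm, Nat.add_sub_cancel, mul_one, Fintype.card_fin]
    have hmq : m ≤ q := by omega
    have hrR : (0 : ℝ) < r := by exact_mod_cast (Nat.zero_le q).trans_lt hqr
    have hN : ((N.descFactorial (m + 1) : ℕ) : ℝ) ≤ (N : ℝ) ^ (m + 1) := by
      exact_mod_cast Nat.descFactorial_le_pow N (m + 1)
    have hr : (r : ℝ) * ((r : ℝ) - q) ^ m ≤ ((r.descFactorial (m + 1) : ℕ) : ℝ) := by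
      obtain ⟨r', rfl⟩ : ∃ r', r = r' + 1 := ⟨r - 1, by omega⟩
      rw [Nat.succ_descFactorial_succ, Nat.cast_mul]
      refine mul_le_mul_of_nonneg_left ?_ hrR.le
      have h3 : (r' + 1 - m) ^ m ≤ r'.descFactorial m := Nat.pow_sub_le_descFactorial r' m
      have h4 : (((r' + 1 : ℕ) : ℝ) - q) ≤ ((r' + 1 - m : ℕ) : ℝ) := by
        rw [Nat.cast_sub (by omega)]
        have : (m : ℝ) ≤ q := by exact_mod_cast hmq
        linarith
      calc (((r' + 1 : ℕ) : ℝ) - q) ^ m ≤ ((r' + 1 - m : ℕ) : ℝ) ^ m := by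
            refine pow_le_pow_left₀ ?_ h4 m
            have : (q : ℝ) ≤ ((r' + 1 : ℕ) : ℝ) := by exact_mod_cast hqr.le
            linarith
        _ ≤ _ := by exact_mod_cast h3
    calc ((N.descFactorial (m + 1) : ℕ) : ℝ) * p ^ m ≤ (N : ℝ) ^ (m + 1) * p ^ m := by gcongr
      _ = N * (N * p) ^ m := by ring
      _ ≤ N * ((r : ℝ) - q) ^ m := by gcongr
      _ = N / r * (r * ((r : ℝ) - q) ^ m) := by field_simp
      _ ≤ N / r * ((r.descFactorial (m + 1) : ℕ) : ℝ) := by gcongr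
  · simp

end Walks

/-! ### Trace moments of random symmetric matrices -/

section WalkExpansion

variable {ι : Type*} [Fintype ι]

/-- Entries of a matrix power as sums over walks. -/
lemma pow_apply_eq_sum_walks [DecidableEq ι] (M : Matrix ι ι ℝ) (l : ℕ) (i j : ι) :
    (M ^ l) i j = ∑ w : Fin (l + 1) → ι, if w 0 = i ∧ w (Fin.last l) = j then
      ∏ t : Fin l, M (w t.castSucc) (w t.succ) else 0 := by
  induction l generalizing i with
  | zero =>
    rw [pow_zero, Fintype.sum_eq_single (fun _ => i)]
    · simp [Matrix.one_apply]
    · intro w hw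
      rw [if_neg]
      rintro ⟨h, -⟩
      refine hw (funext fun t => ?_)
      rw [← h, Fin.fin_one_eq_zero t]
  | succ l ih =>
    rw [pow_succ', Matrix.mul_apply]
    simp_rw [ih, Finset.mul_sum]
    rw [Finset.sum_comm, ← Equiv.sum_comp (Fin.consEquiv fun _ : Fin (l + 1 + 1) => ι),
      Fintype.sum_prod_type_right]
    refine Finset.sum_congr rfl fun w _ => ?_
    rw [Fintype.sum_eq_single (w 0), Fintype.sum_eq_single i]
    · simp [Fin.consEquiv, Fin.prod_univ_succ (n := l), ← Fin.succ_last]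
    · intro k hk
      simp [Fin.consEquiv, hk]
    · intro k hk
      simp [hk.symm]

lemma trace_pow_eq_sum_walks [DecidableEq ι] (M : Matrix ι ι ℝ) (l : ℕ) :
    (M ^ l).trace = ∑ w : Fin (l + 1) → ι, if w 0 = w (Fin.last l) then
      ∏ t : Fin l, M (w t.castSucc) (w t.succ) else 0 := by
  simp_rw [Matrix.trace, Matrix.diag, pow_apply_eq_sum_walks]
  rw [Finset.sum_comm]
  refine Finset.sum_congr rfl fun w _ => ?_
  rw [Fintype.sum_eq_single (w 0)]
  · simp [eq_comm]
  · intro k hk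
    simp [hk.symm]

end WalkExpansion

section SymMatrix

variable {ι : Type*} [LinearOrder ι]

/-- The symmetric matrix with zero diagonal and the entries `z` above the diagonal. -/
def symMatrix (z : {p : ι × ι // p.1 < p.2} → ℝ) : Matrix ι ι ℝ :=
  Matrix.of fun i j => if h : i < j then z ⟨(i, j), h⟩ else if h : j < i then z ⟨(j, i), h⟩ else 0

lemma symMatrix_apply_self (z : {p : ι × ι // p.1 < p.2} → ℝ) (i : ι) : symMatrix z i i = 0 := by
  simp [symMatrix]

lemma symMatrix_apply_of_lt (z : {p : ι × ι // p.1 < p.2} → ℝ) {i j : ι} (h : i < j) :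
    symMatrix z i j = z ⟨(i, j), h⟩ := by
  simp [symMatrix, h]

lemma symMatrix_comm (z : {p : ι × ι // p.1 < p.2} → ℝ) (i j : ι) :
    symMatrix z i j = symMatrix z j i := by
  rcases lt_trichotomy i j with h | rfl | h
  · simp [symMatrix, h, h.not_gt]
  · rfl
  · simp [symMatrix, h, h.not_gt]

lemma isHermitian_symMatrix (z : {p : ι × ι // p.1 < p.2} → ℝ) : (symMatrix z).IsHermitian := by
  ext i j
  simpa using symMatrix_comm z j i

/-- The number of times the walk `w` traverses the edge `e`. -/
def edgeMult {l : ℕ} (w : Fin (l + 1) → ι) (e : {p : ι × ι // p.1 < p.2}) : ℕ :=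
  (Finset.univ.filter fun t => walkEdge w t = s(e.1.1, e.1.2)).card

lemma exists_edge_eq {i j : ι} (h : i ≠ j) :
    ∃ e : {p : ι × ι // p.1 < p.2}, s(i, j) = s(e.1.1, e.1.2) := by
  rcases h.lt_or_gt with h | h
  · exact ⟨⟨(i, j), h⟩, rfl⟩
  · exact ⟨⟨(j, i), h⟩, Sym2.eq_swap⟩

lemma edge_injective :
    Function.Injective fun e : {p : ι × ι // p.1 < p.2} => s(e.1.1, e.1.2) := by
  rintro ⟨⟨i, j⟩, h⟩ ⟨⟨i', j'⟩, h'⟩ hs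
  rcases Sym2.eq_iff.1 hs with ⟨h1, h2⟩ | ⟨h1, h2⟩ <;> dsimp only at h1 h2 h h' <;> subst h1 h2
  · rfl
  · exact absurd h h'.not_gt

/-- A closed loopless walk which is not doubled traverses some edge exactly once. -/
lemma exists_edgeMult_eq_one {l : ℕ} {w : Fin (l + 1) → ι} (hc : w 0 = w (Fin.last l))
    (hl : ∀ t : Fin l, w t.castSucc ≠ w t.succ) (hw : ¬ IsDoubledWalk w) :
    ∃ e, edgeMult w e = 1 := by
  simp only [IsDoubledWalk, not_and, not_forall, not_exists] at hw
  obtain ⟨t, ht⟩ := hw hc hl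
  obtain ⟨e, he⟩ := exists_edge_eq (hl t)
  refine ⟨e, Finset.card_eq_one.2 ⟨t, ?_⟩⟩
  ext t'
  simp only [Finset.mem_filter, Finset.mem_univ, true_and, Finset.mem_singleton]
  constructor
  · intro h
    by_contra hne
    exact ht t' hne (h.trans he.symm)
  · rintro rfl
    exact he

lemma IsDoubledWalk.edgeMult_eq_zero_or_two_le {l : ℕ} {w : Fin (l + 1) → ι}
    (hw : IsDoubledWalk w) (e : {p : ι × ι // p.1 < p.2}) :
    edgeMult w e = 0 ∨ 2 ≤ edgeMult w e := by
  rcases Nat.eq_zero_or_pos (edgeMult w e) with h | h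
  · exact Or.inl h
  · right
    rw [edgeMult, gt_iff_lt, Finset.card_pos] at h
    obtain ⟨t, ht⟩ := h
    obtain ⟨t', hne, ht'⟩ := hw.2.2 t
    have ht2 := (Finset.mem_filter.1 ht).2
    exact Finset.one_lt_card.2
      ⟨t', Finset.mem_filter.2 ⟨Finset.mem_univ _, ht'.trans ht2⟩, t, ht, hne⟩

variable [Fintype ι]

lemma symMatrix_apply_eq_prod (z : {p : ι × ι // p.1 < p.2} → ℝ) {i j : ι} (h : i ≠ j) :
    symMatrix z i j = ∏ e : {p : ι × ι // p.1 < p.2},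
      if s(i, j) = s(e.1.1, e.1.2) then z e else 1 := by
  obtain ⟨e, he⟩ := exists_edge_eq h
  have h1 : symMatrix z i j = z e := by
    obtain ⟨⟨i', j'⟩, h'⟩ := e
    rcases Sym2.eq_iff.1 he with ⟨h1, h2⟩ | ⟨h1, h2⟩ <;> dsimp only at h1 h2 h' <;> subst h1 h2
    · exact symMatrix_apply_of_lt z h'
    · rw [symMatrix_comm, symMatrix_apply_of_lt z h']
  rw [h1, Fintype.prod_eq_single e, if_pos he]
  intro e' he'
  rw [if_neg]
  intro h2
  exact he' (edge_injective (h2.symm.trans he))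

lemma prod_symMatrix_walk {l : ℕ} (z : {p : ι × ι // p.1 < p.2} → ℝ) (w : Fin (l + 1) → ι)
    (hw : ∀ t : Fin l, w t.castSucc ≠ w t.succ) :
    ∏ t : Fin l, symMatrix z (w t.castSucc) (w t.succ) = ∏ e, z e ^ edgeMult w e := by
  simp_rw [fun t => symMatrix_apply_eq_prod z (hw t)]
  rw [Finset.prod_comm]
  refine Finset.prod_congr rfl fun e _ => ?_
  rw [Finset.prod_ite, Finset.prod_const, Finset.prod_const_one, mul_one]
  rfl

/-- The edges with positive multiplicity are the edges traversed by the walk. -/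
lemma card_edgeMult_ne_zero {l : ℕ} (w : Fin (l + 1) → ι)
    (hw : ∀ t : Fin l, w t.castSucc ≠ w t.succ) :
    (Finset.univ.filter fun e => edgeMult w e ≠ 0).card =
      (Finset.univ.image (walkEdge w)).card := by
  refine Finset.card_bij (fun e _ => s(e.1.1, e.1.2)) ?_ (fun _ _ _ _ h => edge_injective h) ?_
  · intro e he
    rw [Finset.mem_filter, edgeMult, Finset.card_ne_zero] at he
    obtain ⟨t, ht⟩ := he.2
    exact Finset.mem_image.2 ⟨t, Finset.mem_univ _, (Finset.mem_filter.1 ht).2⟩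
  · intro x hx
    obtain ⟨t, -, rfl⟩ := Finset.mem_image.1 hx
    obtain ⟨e, he⟩ := exists_edge_eq (hw t)
    refine ⟨e, Finset.mem_filter.2 ⟨Finset.mem_univ _, ?_⟩, he.symm⟩
    rw [edgeMult, Finset.card_ne_zero]
    exact ⟨t, Finset.mem_filter.2 ⟨Finset.mem_univ _, he⟩⟩

end SymMatrix

section TraceMoments

variable {ι : Type*} [LinearOrder ι] {Ω : Type*} [MeasurableSpace Ω] {P : Measure Ω}
  {Z : {p : ι × ι // p.1 < p.2} → Ω → ℝ}

lemma measurable_symMatrix (hm : ∀ e, Measurable (Z e)) (i j : ι) :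
    Measurable fun ω => symMatrix (fun e => Z e ω) i j := by
  unfold symMatrix
  simp only [Matrix.of_apply]
  split_ifs <;> first | exact hm _ | exact measurable_const

lemma abs_symMatrix_le {z : {p : ι × ι // p.1 < p.2} → ℝ} {B : ℝ} (hB : ∀ e, |z e| ≤ B)
    (hB0 : 0 ≤ B) (i j : ι) : |symMatrix z i j| ≤ B := by
  unfold symMatrix
  simp only [Matrix.of_apply]
  split_ifs
  · exact hB _
  · exact hB _
  · simpa using hB0

variable [IsProbabilityMeasure P]

lemma integrable_prod_symMatrix (hm : ∀ e, Measurable (Z e)) {B : ℝ}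
    (hB : ∀ e ω, |Z e ω| ≤ B) (hB0 : 0 ≤ B) {l : ℕ} (w : Fin (l + 1) → ι) :
    Integrable (fun ω => ∏ t : Fin l,
      symMatrix (fun e => Z e ω) (w t.castSucc) (w t.succ)) P := by
  refine Integrable.of_bound (C := B ^ l) ?_ (ae_of_all _ fun ω => ?_)
  · exact (Finset.measurable_prod _ fun t _ => measurable_symMatrix hm _ _).aestronglyMeasurable
  · rw [Real.norm_eq_abs, Finset.abs_prod]
    refine (Finset.prod_le_prod (fun _ _ => abs_nonneg _)
      fun t _ => abs_symMatrix_le (fun e => hB e ω) hB0 _ _).trans_eq ?_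
    simp

variable [Fintype ι]

lemma integrable_trace_pow (hm : ∀ e, Measurable (Z e)) {B : ℝ}
    (hB : ∀ e ω, |Z e ω| ≤ B) (hB0 : 0 ≤ B) (l : ℕ) :
    Integrable (fun ω => ((symMatrix fun e => Z e ω) ^ l).trace) P := by
  simp_rw [trace_pow_eq_sum_walks]
  refine integrable_finsetSum _ fun w _ => ?_
  split_ifs
  · exact integrable_prod_symMatrix hm hB hB0 w
  · exact integrable_zero _ _ _

open Classical in
/-- Expected trace of a power of a random symmetric matrix with independent centered entries: only
doubled walks contribute, because an edge traversed exactly once contributes a vanishing mean. -/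
lemma integral_trace_pow (hm : ∀ e, Measurable (Z e)) {B : ℝ} (hB : ∀ e ω, |Z e ω| ≤ B)
    (hB0 : 0 ≤ B) (hind : iIndepFun Z P) (hmean : ∀ e, ∫ ω, Z e ω ∂P = 0) (l : ℕ) :
    ∫ ω, ((symMatrix fun e => Z e ω) ^ l).trace ∂P =
      ∑ w : Fin (l + 1) → ι, if IsDoubledWalk w then
        ∏ e, ∫ ω, Z e ω ^ edgeMult w e ∂P else 0 := by
  simp_rw [trace_pow_eq_sum_walks]
  rw [integral_finsetSum]
  · refine Finset.sum_congr rfl fun w _ => ?_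
    by_cases hc : w 0 = w (Fin.last l)
    · simp only [hc, if_true]
      by_cases hl : ∀ t : Fin l, w t.castSucc ≠ w t.succ
      · simp_rw [fun ω => prod_symMatrix_walk (fun e => Z e ω) w hl]
        rw [hind.integral_fun_prod_comp (f := fun e x => x ^ edgeMult w e)
          (fun e => (hm e).aemeasurable)
          (fun e => (measurable_id.pow_const _).aestronglyMeasurable)]
        split_ifs with hw
        · rfl
        · obtain ⟨e, he⟩ := exists_edgeMult_eq_one hc hl hw
          refine Finset.prod_eq_zero (Finset.mem_univ e) ?_
          simp [he, hmean]
      · rw [if_neg fun hw : IsDoubledWalk w => hl hw.2.1]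
        push Not at hl
        obtain ⟨t, ht⟩ := hl
        have h0 : ∀ ω, ∏ t : Fin l, symMatrix (fun e => Z e ω) (w t.castSucc) (w t.succ) = 0 :=
          fun ω => Finset.prod_eq_zero (Finset.mem_univ t) (by rw [ht, symMatrix_apply_self])
        simp [h0]
    · simp only [hc, if_false, integral_zero]
      rw [if_neg fun hw : IsDoubledWalk w => hc hw.1]
  · intro w _
    split_ifs
    · exact integrable_prod_symMatrix hm hB hB0 w
    · exact integrable_zero _ _ _

open Classical in
/-- For entries bounded by `1` with second moments at most `p`, each edge of a doubled walk
contributes at most `p`. -/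
lemma integral_trace_pow_le (hm : ∀ e, Measurable (Z e)) (hB : ∀ e ω, |Z e ω| ≤ 1)
    (hind : iIndepFun Z P) (hmean : ∀ e, ∫ ω, Z e ω ∂P = 0) {p : ℝ} (hp : p ≤ 1)
    (hvar : ∀ e, ∫ ω, Z e ω ^ 2 ∂P ≤ p) (hp0 : 0 ≤ p) (l : ℕ) :
    ∫ ω, ((symMatrix fun e => Z e ω) ^ l).trace ∂P ≤
      ∑ w : Fin (l + 1) → ι, if IsDoubledWalk w then p ^ (vertexCount w - 1) else 0 := by
  rw [integral_trace_pow hm hB zero_le_one hind hmean]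
  refine Finset.sum_le_sum fun w _ => ?_
  split_ifs with hw
  · have hint : ∀ (e) (k : ℕ), Integrable (fun ω => |Z e ω| ^ k) P := fun e k =>
      Integrable.of_bound (C := 1) ((hm e).abs.pow_const k).aestronglyMeasurable
        (ae_of_all _ fun ω => by
          rw [Real.norm_eq_abs, abs_of_nonneg (by positivity)]
          exact pow_le_one₀ (abs_nonneg _) (hB e ω))
    have h1 : ∀ e, |∫ ω, Z e ω ^ edgeMult w e ∂P| ≤ if edgeMult w e ≠ 0 then p else 1 := by
      intro e
      rcases hw.edgeMult_eq_zero_or_two_le e with h | h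
      · simp [h]
      · rw [if_pos (by omega)]
        calc |∫ ω, Z e ω ^ edgeMult w e ∂P| ≤ ∫ ω, |Z e ω ^ edgeMult w e| ∂P :=
              abs_integral_le_integral_abs
          _ = ∫ ω, |Z e ω| ^ edgeMult w e ∂P := by simp_rw [abs_pow]
          _ ≤ ∫ ω, |Z e ω| ^ 2 ∂P := integral_mono (hint e _) (hint e 2) fun ω =>
              pow_le_pow_of_le_one (abs_nonneg _) (hB e ω) h
          _ ≤ p := by simpa only [sq_abs] using hvar e
    calc ∏ e, ∫ ω, Z e ω ^ edgeMult w e ∂P ≤ |∏ e, ∫ ω, Z e ω ^ edgeMult w e ∂P| := le_abs_self _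
      _ = ∏ e, |∫ ω, Z e ω ^ edgeMult w e ∂P| := Finset.abs_prod _ _
      _ ≤ ∏ e, (if edgeMult w e ≠ 0 then p else 1) :=
          Finset.prod_le_prod (fun _ _ => abs_nonneg _) fun e _ => h1 e
      _ = p ^ (Finset.univ.image (walkEdge w)).card := by
          rw [← card_edgeMult_ne_zero w hw.2.1, Finset.prod_ite, Finset.prod_const,
            Finset.prod_const_one, mul_one]
      _ ≤ p ^ (vertexCount w - 1) := pow_le_pow_of_le_one hp0 hp (by
          have := vertexCount_le_card_edges w
          omega)
  · exact le_rfl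

open Classical in
/-- For entries all of whose higher moments are at least `1`, every doubled walk contributes at
least `1`. -/
lemma card_doubledWalks_le_integral_trace_pow (hm : ∀ e, Measurable (Z e)) {B : ℝ}
    (hB : ∀ e ω, |Z e ω| ≤ B) (hB0 : 0 ≤ B) (hind : iIndepFun Z P)
    (hmean : ∀ e, ∫ ω, Z e ω ∂P = 0) (hmom : ∀ e, ∀ k ≥ 2, 1 ≤ ∫ ω, Z e ω ^ k ∂P) (l : ℕ) :
    ∑ w : Fin (l + 1) → ι, (if IsDoubledWalk w then (1 : ℝ) else 0) ≤
      ∫ ω, ((symMatrix fun e => Z e ω) ^ l).trace ∂P := by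
  rw [integral_trace_pow hm hB hB0 hind hmean]
  refine Finset.sum_le_sum fun w _ => ?_
  split_ifs with hw
  · refine (Finset.prod_const_one (s := Finset.univ)).symm.trans_le
      (Finset.prod_le_prod (fun _ _ => zero_le_one) fun e _ => ?_)
    rcases hw.edgeMult_eq_zero_or_two_le e with h | h
    · simp [h]
    · exact hmom e _ h
  · exact le_rfl

end TraceMoments

/-! ### Operator norms, nets and traces -/

section Net

open Module

/-- A `1`-net of the ball of radius `2`, of size exponential in the dimension. -/
lemma exists_finset_net (E : Type*) [NormedAddCommGroup E] [NormedSpace ℝ E]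
    [FiniteDimensional ℝ E] :
    ∃ S : Finset E, S.card ≤ 5 ^ finrank ℝ E ∧ (∀ x ∈ S, ‖x‖ ≤ 2) ∧
      ∀ x : E, ‖x‖ ≤ 2 → ∃ y ∈ S, ‖x - y‖ ≤ 1 := by
  classical
  let Q : Finset E → Prop := fun S =>
    (∀ x ∈ S, ‖x‖ ≤ 2) ∧ ∀ x ∈ S, ∀ y ∈ S, x ≠ y → 1 ≤ ‖x - y‖
  have hQ : ∀ S, Q S → S.card ≤ 5 ^ finrank ℝ E := fun S hS =>
    Besicovitch.card_le_of_separated S hS.1 hS.2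
  let R : ℕ → Prop := fun k => ∃ S, Q S ∧ S.card = k
  -- a separated set of the largest possible size is a net
  obtain ⟨S, hS, hcard⟩ : R (Nat.findGreatest R (5 ^ finrank ℝ E)) :=
    Nat.findGreatest_spec (Nat.zero_le _) ⟨∅, by simp [Q], rfl⟩
  refine ⟨S, hQ S hS, hS.1, fun x hx => ?_⟩
  by_contra! hfar
  have hxS : x ∉ S := fun h => by
    have := hfar x h
    rw [sub_self, norm_zero] at this
    linarith
  have hins : Q (insert x S) := by
    refine ⟨fun y hy => ?_, fun y hy z hz hne => ?_⟩
    · rcases Finset.mem_insert.1 hy with rfl | hy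
      · exact hx
      · exact hS.1 y hy
    · rcases Finset.mem_insert.1 hy with rfl | hy' <;>
        rcases Finset.mem_insert.1 hz with rfl | hz'
      · exact absurd rfl hne
      · exact (hfar z hz').le
      · rw [norm_sub_rev]
        exact (hfar y hy').le
      · exact hS.2 y hy' z hz' hne
  have h1 := Nat.le_findGreatest (P := R) (hQ _ hins) ⟨_, hins, rfl⟩
  rw [Finset.card_insert_of_notMem hxS, ← hcard] at h1
  omega

variable {E F : Type*} [NormedAddCommGroup E] [InnerProductSpace ℝ E] [NormedAddCommGroup F]
  [NormedSpace ℝ F]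

lemma exists_opNorm_le_norm_apply_of_net {S : Finset E}
    (hnet : ∀ x : E, ‖x‖ ≤ 2 → ∃ y ∈ S, ‖x - y‖ ≤ 1) (T : E →L[ℝ] F) :
    ∃ y ∈ S, ‖T‖ ≤ ‖T y‖ := by
  obtain ⟨y₀, hy₀, -⟩ := hnet 0 (by simp)
  obtain ⟨y, hy, hmax⟩ := S.exists_max_image (fun y => ‖T y‖) ⟨y₀, hy₀⟩
  refine ⟨y, hy, ?_⟩
  have h : ‖T‖ ≤ (‖T y‖ + ‖T‖) / 2 := by
    refine T.opNorm_le_of_unit_norm (by positivity) fun x hx => ?_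
    obtain ⟨z, hz, hxz⟩ := hnet ((2 : ℝ) • x) (by rw [norm_smul, hx]; norm_num)
    have h1 : ‖T ((2 : ℝ) • x)‖ = 2 * ‖T x‖ := by rw [map_smul, norm_smul]; norm_num
    have h2 : ‖T ((2 : ℝ) • x - z)‖ ≤ ‖T‖ := by
      refine (T.le_opNorm _).trans (mul_le_of_le_one_right (norm_nonneg _) hxz)
    have h3 : ‖T ((2 : ℝ) • x)‖ ≤ ‖T z‖ + ‖T ((2 : ℝ) • x - z)‖ := by
      rw [map_sub]
      exact norm_le_insert' _ _
    have := hmax z hz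
    linarith
  linarith

/-- The operator norm is controlled by the values of the bilinear form on a net. -/
lemma exists_opNorm_le_inner_of_net {S : Finset E}
    (hnet : ∀ x : E, ‖x‖ ≤ 2 → ∃ y ∈ S, ‖x - y‖ ≤ 1) (T : E →L[ℝ] E) :
    ∃ y ∈ S, ∃ z ∈ S, ‖T‖ ≤ |inner ℝ (T y) z| := by
  obtain ⟨y, hy, hTy⟩ := exists_opNorm_le_norm_apply_of_net hnet T
  obtain ⟨z, hz, hTz⟩ := exists_opNorm_le_norm_apply_of_net hnet (innerSL ℝ (T y))
  refine ⟨y, hy, z, hz, hTy.trans ?_⟩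
  simpa using hTz

end Net

section TraceNorm

open scoped Matrix.Norms.L2Operator

variable {ι : Type*} [Fintype ι] [DecidableEq ι]

lemma abs_apply_le_l2_opNorm (M : Matrix ι ι ℝ) (i j : ι) : |M i j| ≤ ‖M‖ := by
  have h1 := Matrix.l2_opNorm_mulVec M (EuclideanSpace.single j (1 : ℝ))
  rw [PiLp.norm_single, norm_one, mul_one] at h1
  have h2 := PiLp.norm_apply_le (WithLp.toLp 2 (M.mulVec (EuclideanSpace.single j (1 : ℝ)).ofLp)) i
  refine le_trans (le_of_eq ?_) (h2.trans h1)
  simp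

lemma trace_pow_le_card_mul_norm_pow (M : Matrix ι ι ℝ) {l : ℕ} (hl : 0 < l) :
    (M ^ l).trace ≤ Fintype.card ι * ‖M‖ ^ l := by
  calc (M ^ l).trace ≤ ∑ _i : ι, ‖M‖ ^ l := Finset.sum_le_sum fun i _ =>
        (le_abs_self _).trans ((abs_apply_le_l2_opNorm _ i i).trans (norm_pow_le' M hl))
    _ = _ := by simp

/-- The operator norm is at most the Frobenius norm. -/
lemma l2_opNorm_sq_le_sum_sq (M : Matrix ι ι ℝ) : ‖M‖ ^ 2 ≤ ∑ i, ∑ j, M i j ^ 2 := by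
  have h0 : 0 ≤ ∑ i, ∑ j, M i j ^ 2 := Finset.sum_nonneg fun _ _ =>
    Finset.sum_nonneg fun _ _ => sq_nonneg _
  have h : ‖M‖ ≤ √(∑ i, ∑ j, M i j ^ 2) := by
    rw [← Matrix.l2_opNorm_toEuclideanCLM]
    refine ContinuousLinearMap.opNorm_le_bound _ (Real.sqrt_nonneg _) fun x => ?_
    refine le_of_sq_le_sq ?_ (by positivity)
    rw [mul_pow, Real.sq_sqrt h0, EuclideanSpace.real_norm_sq_eq, EuclideanSpace.real_norm_sq_eq,
      Finset.sum_mul]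
    refine Finset.sum_le_sum fun i _ => ?_
    rw [Matrix.ofLp_toEuclideanCLM]
    exact Finset.sum_mul_sq_le_sq_mul_sq _ _ _
  exact (pow_le_pow_left₀ (norm_nonneg _) h 2).trans_eq (Real.sq_sqrt h0)

lemma norm_pow_le_trace_pow {M : Matrix ι ι ℝ} (hM : M.IsHermitian) (j : ℕ) :
    ‖M‖ ^ (2 * 2 ^ j) ≤ (M ^ (2 * 2 ^ j)).trace := by
  have h1 : ‖M‖ ^ (2 ^ j) = ‖M ^ (2 ^ j)‖ :=
    (IsSelfAdjoint.norm_pow_two_pow (show IsSelfAdjoint M from hM) j).symm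
  have hsymm : ∀ i k, (M ^ (2 ^ j)) k i = (M ^ (2 ^ j)) i k := fun i k => by
    simpa using (hM.pow (2 ^ j)).apply i k
  rw [mul_comm, pow_mul, pow_mul, h1, pow_two (M ^ 2 ^ j)]
  refine (l2_opNorm_sq_le_sum_sq _).trans_eq ?_
  rw [Matrix.trace]
  refine Finset.sum_congr rfl fun i _ => ?_
  rw [Matrix.diag_apply, Matrix.mul_apply]
  exact Finset.sum_congr rfl fun k _ => by rw [hsymm i k, sq]

end TraceNorm

section BilinearForm

variable {ι : Type*} [LinearOrder ι] [Fintype ι]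

/-- A sum over ordered pairs, split into the diagonal and the unordered pairs. -/
lemma sum_sum_eq_diag_add_sum_edges (g : ι → ι → ℝ) :
    ∑ i, ∑ j, g i j = ∑ i, g i i +
      ∑ e : {p : ι × ι // p.1 < p.2}, (g e.1.1 e.1.2 + g e.1.2 e.1.1) := by
  have h1 : ∀ h : ι × ι → ℝ, ∑ e : {p : ι × ι // p.1 < p.2}, h e.1 =
      ∑ p : ι × ι, if p.1 < p.2 then h p else 0 := fun h => by
    rw [← Finset.sum_filter]
    exact (Finset.sum_subtype _ (by simp) _).symm
  rw [Finset.sum_add_distrib, h1 fun p => g p.1 p.2, h1 fun p => g p.2 p.1,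
    Fintype.sum_prod_type, Fintype.sum_prod_type_right, ← Finset.sum_add_distrib,
    ← Finset.sum_add_distrib]
  refine Finset.sum_congr rfl fun i _ => ?_
  have h2 : g i i = ∑ j, if i = j then g i j else 0 := by simp
  rw [h2, ← Finset.sum_add_distrib, ← Finset.sum_add_distrib]
  refine Finset.sum_congr rfl fun j _ => ?_
  rcases lt_trichotomy i j with h | rfl | h
  · simp [h, h.ne, h.not_gt]
  · simp
  · simp [h, h.ne', h.not_gt]

lemma inner_symMatrix (z : {p : ι × ι // p.1 < p.2} → ℝ) (x y : EuclideanSpace ℝ ι) :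
    inner ℝ (Matrix.toEuclideanCLM (𝕜 := ℝ) (symMatrix z) x) y =
      ∑ e : {p : ι × ι // p.1 < p.2}, (x e.1.1 * y e.1.2 + x e.1.2 * y e.1.1) * z e := by
  have h1 : inner ℝ (Matrix.toEuclideanCLM (𝕜 := ℝ) (symMatrix z) x) y =
      ∑ i, ∑ j, y i * (symMatrix z i j * x j) := by
    simp [PiLp.inner_apply, Matrix.mulVec, dotProduct, Finset.mul_sum]
  rw [h1, sum_sum_eq_diag_add_sum_edges]
  simp only [symMatrix_apply_self, zero_mul, mul_zero, Finset.sum_const_zero, zero_add]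
  refine Finset.sum_congr rfl fun e _ => ?_
  rw [symMatrix_comm z e.1.2 e.1.1, symMatrix_apply_of_lt z e.2]
  ring

lemma sum_sq_coeff_le (x y : EuclideanSpace ℝ ι) :
    ∑ e : {p : ι × ι // p.1 < p.2}, (x e.1.1 * y e.1.2 + x e.1.2 * y e.1.1) ^ 2 ≤
      2 * (‖x‖ ^ 2 * ‖y‖ ^ 2) := by
  have h := sum_sum_eq_diag_add_sum_edges fun i j => x i ^ 2 * y j ^ 2
  have h0 : 0 ≤ ∑ i, x i ^ 2 * y i ^ 2 := Finset.sum_nonneg fun _ _ => by positivity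
  rw [EuclideanSpace.real_norm_sq_eq, EuclideanSpace.real_norm_sq_eq, Finset.sum_mul_sum, h]
  have h2 : ∑ e : {p : ι × ι // p.1 < p.2}, (x e.1.1 * y e.1.2 + x e.1.2 * y e.1.1) ^ 2 ≤
      ∑ e : {p : ι × ι // p.1 < p.2},
        2 * (x e.1.1 ^ 2 * y e.1.2 ^ 2 + x e.1.2 ^ 2 * y e.1.1 ^ 2) :=
    Finset.sum_le_sum fun e _ => by nlinarith [sq_nonneg (x e.1.1 * y e.1.2 - x e.1.2 * y e.1.1)]
  rw [← Finset.mul_sum] at h2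
  linarith

end BilinearForm

/-! ### The comparison matrix and the norm of the noise -/

section Comparison

open scoped Matrix.Norms.L2Operator

/-- The centered law on `{2, -1}` with weights `1/3` and `2/3`. -/
noncomputable def twoPointLaw : Measure ℝ :=
  ENNReal.ofReal (1 / 3) • Measure.dirac 2 + ENNReal.ofReal (2 / 3) • Measure.dirac (-1)

instance : IsProbabilityMeasure twoPointLaw := ⟨by
  simp only [twoPointLaw, Measure.coe_add, Measure.coe_smul, Pi.add_apply, Pi.smul_apply,
    measure_univ, smul_eq_mul, mul_one]
  rw [← ENNReal.ofReal_add (by norm_num) (by norm_num)]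
  norm_num⟩

lemma integral_twoPointLaw (g : ℝ → ℝ) :
    ∫ x, g x ∂twoPointLaw = (g 2 + 2 * g (-1)) / 3 := by
  rw [twoPointLaw, integral_add_measure, integral_smul_measure, integral_smul_measure,
    integral_dirac, integral_dirac, ENNReal.toReal_ofReal (by norm_num),
    ENNReal.toReal_ofReal (by norm_num)]
  · simp only [smul_eq_mul]
    ring
  · exact (integrable_dirac (by simp)).smul_measure ENNReal.ofReal_ne_top
  · exact (integrable_dirac (by simp)).smul_measure ENNReal.ofReal_ne_top

lemma ae_twoPointLaw_mem : ∀ᵐ x ∂twoPointLaw, x ∈ Set.Icc (-1 : ℝ) 2 := by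
  rw [twoPointLaw, ae_add_measure_iff]
  constructor <;> refine Measure.ae_smul_measure
    ((ae_dirac_iff (p := fun x => x ∈ Set.Icc (-1 : ℝ) 2) measurableSet_Icc).2 ?_) _ <;> norm_num

lemma one_le_integral_pow_twoPointLaw {k : ℕ} (hk : 2 ≤ k) :
    1 ≤ ∫ x, x ^ k ∂twoPointLaw := by
  rw [integral_twoPointLaw fun x => x ^ k]
  rcases hk.lt_or_eq with h | rfl
  · have h1 : (2 : ℝ) ^ 3 ≤ 2 ^ k := pow_le_pow_right₀ (by norm_num) h
    have h2 : -1 ≤ (-1 : ℝ) ^ k := by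
      rcases neg_one_pow_eq_or ℝ k with h | h <;> rw [h]; norm_num
    linarith
  · norm_num

/-- The joint law of the entries of the `r × r` comparison matrix. -/
noncomputable def comparisonLaw (r : ℕ) : Measure ({p : Fin r × Fin r // p.1 < p.2} → ℝ) :=
  Measure.pi fun _ => twoPointLaw

instance (r : ℕ) : IsProbabilityMeasure (comparisonLaw r) := by
  unfold comparisonLaw; infer_instance

/-- Truncation of a coordinate to `[-1, 2]`, which contains the support of its law, so that the
bounds on the entries hold everywhere. -/
noncomputable def comparisonEntry {r : ℕ} (e : {p : Fin r × Fin r // p.1 < p.2})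
    (η : {p : Fin r × Fin r // p.1 < p.2} → ℝ) : ℝ := max (-1) (min (η e) 2)

variable {r : ℕ}

lemma measurable_comparisonEntry (e : {p : Fin r × Fin r // p.1 < p.2}) :
    Measurable (comparisonEntry e) :=
  measurable_const.max ((measurable_pi_apply e).min measurable_const)

lemma comparisonEntry_mem (e : {p : Fin r × Fin r // p.1 < p.2})
    (η : {p : Fin r × Fin r // p.1 < p.2} → ℝ) : comparisonEntry e η ∈ Set.Icc (-1 : ℝ) 2 :=
  ⟨le_max_left _ _, max_le (by norm_num) (min_le_right _ _)⟩

lemma abs_comparisonEntry_le (e : {p : Fin r × Fin r // p.1 < p.2})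
    (η : {p : Fin r × Fin r // p.1 < p.2} → ℝ) : |comparisonEntry e η| ≤ 2 :=
  abs_le.2 ⟨by linarith [(comparisonEntry_mem e η).1], (comparisonEntry_mem e η).2⟩

lemma iIndepFun_comparisonEntry :
    iIndepFun (comparisonEntry (r := r)) (comparisonLaw r) :=
  iIndepFun_pi (X := fun _ x => max (-1 : ℝ) (min x 2)) fun _ =>
    (measurable_const.max (measurable_id.min measurable_const)).aemeasurable

lemma integral_pow_comparisonEntry (e : {p : Fin r × Fin r // p.1 < p.2}) (k : ℕ) :
    ∫ η, comparisonEntry e η ^ k ∂comparisonLaw r = ∫ x, x ^ k ∂twoPointLaw := by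
  have h := (measurePreserving_eval (fun _ : {p : Fin r × Fin r // p.1 < p.2} => twoPointLaw)
    e).map_eq
  rw [← integral_congr_ae (f := fun x => (max (-1 : ℝ) (min x 2)) ^ k), ← h, integral_map]
  · rfl
  · exact (measurable_pi_apply e).aemeasurable
  · exact ((measurable_const.max (measurable_id.min measurable_const)).pow_const
      k).aestronglyMeasurable
  · filter_upwards [ae_twoPointLaw_mem] with x hx
    rw [min_eq_left hx.2, max_eq_right hx.1]

lemma integral_comparisonEntry (e : {p : Fin r × Fin r // p.1 < p.2}) :
    ∫ η, comparisonEntry e η ∂comparisonLaw r = 0 := by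
  have h := integral_pow_comparisonEntry e 1
  simp only [pow_one] at h
  rw [h, integral_twoPointLaw fun x => x]
  norm_num

/-- Moments of the bilinear form of the comparison matrix, by the sub-Gaussian bound for its moment
generating function at `± √r`. -/
lemma integral_inner_pow_le {q : ℕ} (hq : 0 < q) (x y : EuclideanSpace ℝ (Fin (2 * q)))
    (hx : ‖x‖ ≤ 2) (hy : ‖y‖ ≤ 2) :
    Integrable (fun η => inner ℝ (Matrix.toEuclideanCLM (𝕜 := ℝ)
      (symMatrix fun e => comparisonEntry e η) x) y ^ (2 * q)) (comparisonLaw (2 * q)) ∧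
    ∫ η, inner ℝ (Matrix.toEuclideanCLM (𝕜 := ℝ)
      (symMatrix fun e => comparisonEntry e η) x) y ^ (2 * q) ∂comparisonLaw (2 * q) ≤
      2 * (2 * q : ℝ) ^ q * Real.exp 36 ^ (2 * q) := by
  set a : {p : Fin (2 * q) × Fin (2 * q) // p.1 < p.2} → ℝ := fun e =>
    x e.1.1 * y e.1.2 + x e.1.2 * y e.1.1 with ha
  set B : ({p : Fin (2 * q) × Fin (2 * q) // p.1 < p.2} → ℝ) → ℝ := fun η =>
    ∑ e, a e * comparisonEntry e η with hB
  have hBeq : ∀ η, inner ℝ (Matrix.toEuclideanCLM (𝕜 := ℝ)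
      (symMatrix fun e => comparisonEntry e η) x) y = B η := fun η => inner_symMatrix _ x y
  simp_rw [hBeq]
  have hBm : Measurable B :=
    Finset.measurable_sum _ fun e _ => (measurable_comparisonEntry e).const_mul _
  obtain ⟨C, hC, hsub⟩ : ∃ C : NNReal, (C : ℝ) ≤ 72 ∧
      HasSubgaussianMGF B C (comparisonLaw (2 * q)) := by
    refine ⟨∑ e, ‖a e‖₊ ^ 2 * (9 / 4), ?_, HasSubgaussianMGF.sum_of_iIndepFun
      (X := fun e η => a e * comparisonEntry e η) ?_ fun e _ => ?_⟩
    · have h1 : ∑ e, a e ^ 2 ≤ 2 * (‖x‖ ^ 2 * ‖y‖ ^ 2) := sum_sq_coeff_le x y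
      have h2 : ‖x‖ ^ 2 * ‖y‖ ^ 2 ≤ 2 ^ 2 * 2 ^ 2 := by gcongr
      push_cast
      simp only [Real.norm_eq_abs, sq_abs]
      rw [← Finset.sum_mul]
      linarith
    · exact iIndepFun_comparisonEntry.comp (fun e x => a e * x) fun e => measurable_const_mul _
    · have h := (hasSubgaussianMGF_of_mem_Icc_of_integral_eq_zero
        (measurable_comparisonEntry e).aemeasurable (ae_of_all _ fun η => comparisonEntry_mem e η)
        (integral_comparisonEntry e)).const_mul (a e)
      convert h using 1
      refine NNReal.eq ?_
      have h3 : ‖(2 : ℝ) - (-1)‖ = 3 := by norm_num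
      change ‖a e‖ ^ 2 * (9 / 4) = a e ^ 2 * (‖(2 : ℝ) - (-1)‖ / 2) ^ 2
      rw [h3, Real.norm_eq_abs, sq_abs]
      norm_num
  set s : ℝ := √(2 * q) with hs
  have hs2 : s ^ 2 = 2 * q := Real.sq_sqrt (by positivity)
  have hqR : (0 : ℝ) < q := by exact_mod_cast hq
  have hs0 : 0 < s := Real.sqrt_pos.2 (by positivity)
  have hmgf : ∀ t : ℝ, t ^ 2 = s ^ 2 →
      ∫ η, Real.exp (t * B η) ∂comparisonLaw (2 * q) ≤ Real.exp 36 ^ (2 * q) := fun t ht => by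
    refine (hsub.mgf_le t).trans ?_
    rw [← Real.exp_nat_mul, ht, hs2]
    refine Real.exp_le_exp.2 ?_
    push_cast
    nlinarith
  have hpt : ∀ η, B η ^ (2 * q) ≤ (2 * q : ℝ) ^ q *
      (Real.exp (s * B η) + Real.exp (-s * B η)) := fun η => by
    have h1 := Real.pow_div_factorial_le_exp _ (abs_nonneg (s * B η)) (2 * q)
    have h2 : Real.exp |s * B η| ≤ Real.exp (s * B η) + Real.exp (-s * B η) := by
      rw [neg_mul]
      exact Real.exp_abs_le _
    have h3 : (((2 * q).factorial : ℕ) : ℝ) ≤ (2 * q : ℝ) ^ (2 * q) := by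
      exact_mod_cast Nat.factorial_le_pow (2 * q)
    have h4 : |s * B η| ^ (2 * q) = (2 * q : ℝ) ^ q * B η ^ (2 * q) := by
      rw [(even_two_mul q).pow_abs, mul_pow, pow_mul s, hs2]
    rw [div_le_iff₀ (by positivity), h4] at h1
    have h5 : (2 * q : ℝ) ^ q * B η ^ (2 * q) ≤ (2 * q : ℝ) ^ q * ((2 * q : ℝ) ^ q *
        (Real.exp (s * B η) + Real.exp (-s * B η))) := by
      refine h1.trans ?_
      calc Real.exp |s * B η| * ((2 * q).factorial : ℕ)
          ≤ (Real.exp (s * B η) + Real.exp (-s * B η)) * (2 * q : ℝ) ^ (2 * q) := by gcongr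
        _ = _ := by ring
    exact le_of_mul_le_mul_left h5 (by positivity)
  have hint : Integrable (fun η => (2 * q : ℝ) ^ q *
      (Real.exp (s * B η) + Real.exp (-s * B η))) (comparisonLaw (2 * q)) :=
    ((hsub.integrable_exp_mul s).add (hsub.integrable_exp_mul (-s))).const_mul _
  have hintB : Integrable (fun η => B η ^ (2 * q)) (comparisonLaw (2 * q)) :=
    hint.mono' (hBm.pow_const _).aestronglyMeasurable (ae_of_all _ fun η => by
      rw [Real.norm_eq_abs, abs_of_nonneg ((even_two_mul q).pow_nonneg _)]
      exact hpt η)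
  refine ⟨hintB, (integral_mono hintB hint hpt).trans ?_⟩
  rw [integral_const_mul, integral_add (hsub.integrable_exp_mul s) (hsub.integrable_exp_mul (-s))]
  have h1 := hmgf s rfl
  have h2 := hmgf (-s) (neg_sq s)
  calc (2 * q : ℝ) ^ q * (∫ η, Real.exp (s * B η) ∂comparisonLaw (2 * q) +
        ∫ η, Real.exp (-s * B η) ∂comparisonLaw (2 * q))
      ≤ (2 * q : ℝ) ^ q * (Real.exp 36 ^ (2 * q) + Real.exp 36 ^ (2 * q)) := by gcongr
    _ = _ := by ring

/-- Trace moments of the comparison matrix at the order of its dimension: the union bound over a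
net costs a factor exponential in the dimension, which is harmless at this order. -/
lemma integral_trace_pow_comparison_le {q : ℕ} (hq : 0 < q) :
    ∫ η, ((symMatrix fun e => comparisonEntry e η) ^ (2 * q)).trace ∂comparisonLaw (2 * q) ≤
      (2 * q : ℝ) * (2 * (2 * q : ℝ) ^ q * (25 * Real.exp 36) ^ (2 * q)) := by
  obtain ⟨S, hScard, hSnorm, hSnet⟩ := exists_finset_net (EuclideanSpace ℝ (Fin (2 * q)))
  rw [finrank_euclideanSpace_fin] at hScard
  set T : ({p : Fin (2 * q) × Fin (2 * q) // p.1 < p.2} → ℝ) →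
      EuclideanSpace ℝ (Fin (2 * q)) → EuclideanSpace ℝ (Fin (2 * q)) → ℝ := fun η x y =>
    inner ℝ (Matrix.toEuclideanCLM (𝕜 := ℝ) (symMatrix fun e => comparisonEntry e η) x) y ^ (2 * q)
    with hT
  have hT0 : ∀ η x y, 0 ≤ T η x y := fun η x y => (even_two_mul q).pow_nonneg _
  have hTint : ∀ x ∈ S, ∀ y ∈ S, Integrable (fun η => T η x y) (comparisonLaw (2 * q)) :=
    fun x hx y hy => (integral_inner_pow_le hq x y (hSnorm x hx) (hSnorm y hy)).1
  have hpt : ∀ η, ((symMatrix fun e => comparisonEntry e η) ^ (2 * q)).trace ≤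
      (2 * q : ℝ) * ∑ x ∈ S, ∑ y ∈ S, T η x y := fun η => by
    have h1 := trace_pow_le_card_mul_norm_pow (symMatrix fun e => comparisonEntry e η)
      (show 0 < 2 * q by omega)
    rw [Fintype.card_fin] at h1
    push_cast at h1
    refine h1.trans (mul_le_mul_of_nonneg_left ?_ (by positivity))
    obtain ⟨x, hx, y, hy, hxy⟩ := exists_opNorm_le_inner_of_net hSnet
      (Matrix.toEuclideanCLM (𝕜 := ℝ) (symMatrix fun e => comparisonEntry e η))
    rw [Matrix.l2_opNorm_toEuclideanCLM] at hxy
    calc ‖symMatrix fun e => comparisonEntry e η‖ ^ (2 * q) ≤ T η x y :=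
          (pow_le_pow_left₀ (norm_nonneg _) hxy (2 * q)).trans_eq ((even_two_mul q).pow_abs _)
      _ ≤ ∑ y ∈ S, T η x y :=
          Finset.single_le_sum (f := fun y => T η x y) (fun y _ => hT0 η x y) hy
      _ ≤ _ := Finset.single_le_sum (f := fun x => ∑ y ∈ S, T η x y)
          (fun x _ => Finset.sum_nonneg fun y _ => hT0 η x y) hx
  have hint := integrable_trace_pow (P := comparisonLaw (2 * q))
    (measurable_comparisonEntry (r := 2 * q)) abs_comparisonEntry_le zero_le_two (2 * q)
  have hint2 : Integrable (fun η => ∑ x ∈ S, ∑ y ∈ S, T η x y) (comparisonLaw (2 * q)) :=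
    integrable_finsetSum _ fun x hx => integrable_finsetSum _ fun y hy => hTint x hx y hy
  refine (integral_mono hint (hint2.const_mul _) hpt).trans ?_
  rw [integral_const_mul]
  refine mul_le_mul_of_nonneg_left ?_ (by positivity)
  rw [integral_finsetSum _ fun x hx => integrable_finsetSum _ fun y hy => hTint x hx y hy]
  have hS : (S.card : ℝ) ≤ 5 ^ (2 * q) := by exact_mod_cast hScard
  calc ∑ x ∈ S, ∫ η, ∑ y ∈ S, T η x y ∂comparisonLaw (2 * q)
      = ∑ x ∈ S, ∑ y ∈ S, ∫ η, T η x y ∂comparisonLaw (2 * q) :=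
        Finset.sum_congr rfl fun x hx => integral_finsetSum _ fun y hy => hTint x hx y hy
    _ ≤ ∑ _x ∈ S, ∑ _y ∈ S, 2 * (2 * q : ℝ) ^ q * Real.exp 36 ^ (2 * q) :=
        Finset.sum_le_sum fun x hx => Finset.sum_le_sum fun y hy =>
          (integral_inner_pow_le hq x y (hSnorm x hx) (hSnorm y hy)).2
    _ = (S.card : ℝ) * (S.card * (2 * (2 * q : ℝ) ^ q * Real.exp 36 ^ (2 * q))) := by
        simp only [Finset.sum_const, nsmul_eq_mul]
    _ ≤ 5 ^ (2 * q) * (5 ^ (2 * q) * (2 * (2 * q : ℝ) ^ q * Real.exp 36 ^ (2 * q))) := by gcongr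
    _ = 2 * (2 * q : ℝ) ^ q * (25 * Real.exp 36) ^ (2 * q) := by
        rw [mul_pow (25 : ℝ), show (25 : ℝ) = 5 * 5 by norm_num, mul_pow (5 : ℝ)]
        ring

/-- The absolute constant in the bound for the norm of the noise. -/
noncomputable def noiseConst : ℝ := 100 * Real.exp 36

lemma noiseConst_pos : 0 < noiseConst := by unfold noiseConst; positivity

variable {ι : Type*} [LinearOrder ι] [Fintype ι] {Ω : Type*} [MeasurableSpace Ω] {P : Measure Ω}
  [IsProbabilityMeasure P] {Z : {p : ι × ι // p.1 < p.2} → Ω → ℝ}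

/-- Sharp norm bound for sparse symmetric random matrices, without a logarithmic factor, valid at
densities for which the expected degree is at most `q`. -/
lemma measureReal_norm_symMatrix_ge_le (hm : ∀ e, Measurable (Z e)) (hB : ∀ e ω, |Z e ω| ≤ 1)
    (hind : iIndepFun Z P) (hmean : ∀ e, ∫ ω, Z e ω ∂P = 0) {p : ℝ} (hp0 : 0 ≤ p) (hp : p ≤ 1)
    (hvar : ∀ e, ∫ ω, Z e ω ^ 2 ∂P ≤ p) (j : ℕ) (hcard : Fintype.card ι * p ≤ (2 : ℝ) ^ j) :
    P.real {ω | noiseConst * √((2 : ℝ) ^ j) ≤ ‖symMatrix fun e => Z e ω‖} ≤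
      Fintype.card ι * (1 / 4) ^ (2 ^ j) := by
  classical
  obtain ⟨q, hq⟩ : ∃ q, q = 2 ^ j := ⟨_, rfl⟩
  have hq0 : 0 < q := hq ▸ Nat.two_pow_pos j
  have hqR : (0 : ℝ) < q := by exact_mod_cast hq0
  have hqj : (2 : ℝ) ^ j = q := by rw [hq]; norm_num
  rw [hqj] at hcard ⊢
  rw [← hq]
  set N : ℝ := (Fintype.card ι : ℝ) with hN
  set tr : Ω → ℝ := fun ω => ((symMatrix fun e => Z e ω) ^ (2 * q)).trace with htr
  have hnorm : ∀ ω, ‖symMatrix fun e => Z e ω‖ ^ (2 * q) ≤ tr ω := fun ω => by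
    have := norm_pow_le_trace_pow (isHermitian_symMatrix fun e => Z e ω) j
    rwa [← hq] at this
  have hmoment : ∫ ω, tr ω ∂P ≤ N * (2 * (2 * q : ℝ) ^ q * (25 * Real.exp 36) ^ (2 * q)) := by
    calc ∫ ω, tr ω ∂P
        ≤ ∑ w : Fin (2 * q + 1) → ι, (if IsDoubledWalk w then p ^ (vertexCount w - 1) else 0) :=
          integral_trace_pow_le hm hB hind hmean hp hvar hp0 _
      _ ≤ N / (2 * q : ℕ) * ∑ w : Fin (2 * q + 1) → Fin (2 * q),
            (if IsDoubledWalk w then (1 : ℝ) else 0) :=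
          sum_doubledWalks_le hp0 (by omega) (by push_cast; linarith)
      _ ≤ N / (2 * q : ℕ) * ((2 * q : ℝ) *
            (2 * (2 * q : ℝ) ^ q * (25 * Real.exp 36) ^ (2 * q))) := by
          refine mul_le_mul_of_nonneg_left ?_ (by positivity)
          refine (card_doubledWalks_le_integral_trace_pow (measurable_comparisonEntry (r := 2 * q))
            abs_comparisonEntry_le zero_le_two iIndepFun_comparisonEntry integral_comparisonEntry
            (fun e k hk => ?_) (2 * q)).trans (integral_trace_pow_comparison_le hq0)
          rw [integral_pow_comparisonEntry]
          exact one_le_integral_pow_twoPointLaw hk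
      _ = _ := by
          push_cast
          field_simp
  set τ : ℝ := (noiseConst * √q) ^ (2 * q) with hτ
  have hτ0 : 0 < τ := pow_pos (mul_pos noiseConst_pos (Real.sqrt_pos.2 hqR)) _
  have hτeq : τ = 16 ^ q * ((q : ℝ) ^ q * (25 * Real.exp 36) ^ (2 * q)) := by
    rw [hτ, noiseConst, show 100 * Real.exp 36 * √q = 4 * (25 * Real.exp 36) * √q by ring,
      mul_pow, mul_pow, pow_mul √(q : ℝ), Real.sq_sqrt hqR.le, pow_mul (4 : ℝ)]
    norm_num
    ring
  have hmarkov := mul_meas_ge_le_integral_of_nonneg (μ := P) (f := tr)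
    (ae_of_all _ fun ω => (pow_nonneg (norm_nonneg _) _).trans (hnorm ω))
    (integrable_trace_pow hm hB zero_le_one _) τ
  have hsub : P.real {ω | noiseConst * √q ≤ ‖symMatrix fun e => Z e ω‖} ≤
      P.real {ω | τ ≤ tr ω} := by
    refine measureReal_mono (fun ω hω => ?_)
    exact (pow_le_pow_left₀ (mul_nonneg noiseConst_pos.le (Real.sqrt_nonneg _)) hω _).trans
      (hnorm ω)
  refine hsub.trans ?_
  have h1 : τ * P.real {ω | τ ≤ tr ω} ≤ τ * (N * (1 / 4) ^ q) := by
    refine (hmarkov.trans hmoment).trans ?_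
    rw [hτeq, mul_pow (2 : ℝ) (q : ℝ)]
    have h2 : (2 : ℝ) * 2 ^ q ≤ 16 ^ q * (1 / 4) ^ q := by
      rw [← mul_pow, show (16 : ℝ) * (1 / 4) = 2 * 2 by norm_num, mul_pow]
      refine mul_le_mul_of_nonneg_right ?_ (by positivity)
      calc (2 : ℝ) = 2 ^ 1 := (pow_one 2).symm
        _ ≤ 2 ^ q := pow_le_pow_right₀ (by norm_num) hq0
    calc N * (2 * (2 ^ q * (q : ℝ) ^ q) * (25 * Real.exp 36) ^ (2 * q))
        = (2 * 2 ^ q) * (N * ((q : ℝ) ^ q * (25 * Real.exp 36) ^ (2 * q))) := by ring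
      _ ≤ (16 ^ q * (1 / 4) ^ q) * (N * ((q : ℝ) ^ q * (25 * Real.exp 36) ^ (2 * q))) := by
          gcongr
      _ = _ := by ring
  exact le_of_mul_le_mul_left h1 hτ0

end Comparison

/-! ### Noise in the diagonal blocks of the adjacency matrix -/

section EntryBound

open scoped Matrix.Norms.L2Operator

variable {n K : ℕ} {Θ : Matrix (Fin n) (Fin n) ℝ} {p : ℝ}

/-- The criterion is at most the size of a block times the largest entry. -/
lemma IsBalanced.f_le_of_entry_le (hΘ0 : ∀ i j, 0 ≤ Θ i j) (hΘp : ∀ i j, Θ i j ≤ p)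
    (hp0 : 0 ≤ p) {C : ℝ} (hC : 0 ≤ C) {c : Fin n → Fin K} (hc : IsBalanced C c) :
    f c Θ ≤ C * n / K * p := by
  refine f_le_of_forall (by positivity) fun k => (sigmaTwo_le_norm _).trans ?_
  refine le_trans ?_ (mul_le_mul_of_nonneg_right (hc k).2 hp0)
  refine le_of_sq_le_sq ((l2_opNorm_sq_le_sum_sq _).trans ?_) (by positivity)
  calc ∑ i, ∑ j, diagBlock c Θ k i j ^ 2
      ≤ ∑ _i : {i // c i = k}, ∑ _j : {i // c i = k}, p ^ 2 :=
        Finset.sum_le_sum fun i _ => Finset.sum_le_sum fun j _ =>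
          pow_le_pow_left₀ (hΘ0 _ _) (hΘp _ _) 2
    _ = (communitySize c k * p) ^ 2 := by
        simp only [Finset.sum_const, nsmul_eq_mul, Finset.card_univ, communitySize]
        ring

end EntryBound

section BlockNoise

open scoped Matrix.Norms.L2Operator

variable {Ω : Type*} [MeasurableSpace Ω] {P : Measure Ω} {n : ℕ}
  {Θ : Matrix (Fin n) (Fin n) ℝ} {A : Ω → Matrix (Fin n) (Fin n) ℝ}

lemma IsRandomAdjacency.integral_eq (hA : IsRandomAdjacency P Θ A) {i j : Fin n} (hij : i < j) :
    ∫ ω, A ω i j ∂P = Θ i j := by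
  have h : (fun ω => A ω i j) = {ω | A ω i j = 1}.indicator 1 := by
    ext ω
    rcases hA.zero_or_one ω i j with h | h <;> simp [h]
  rw [h, integral_indicator_one (measurableSet_eq_fun (hA.measurable i j) measurable_const),
    hA.prob i j hij]

variable [IsProbabilityMeasure P]

lemma IsRandomAdjacency.integrable (hA : IsRandomAdjacency P Θ A) (i j : Fin n) :
    Integrable (fun ω => A ω i j) P :=
  Integrable.of_bound (C := 1) (hA.measurable i j).aestronglyMeasurable (ae_of_all _ fun ω => by
    rcases hA.zero_or_one ω i j with h | h <;> simp [h])

lemma IsRandomAdjacency.integral_sub_sq_le (hA : IsRandomAdjacency P Θ A) {i j : Fin n}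
    (hij : i < j) : ∫ ω, (A ω i j - Θ i j) ^ 2 ∂P ≤ Θ i j := by
  have h : ∀ ω, (A ω i j - Θ i j) ^ 2 = (1 - 2 * Θ i j) * A ω i j + Θ i j ^ 2 := fun ω => by
    rcases hA.zero_or_one ω i j with h | h <;> rw [h] <;> ring
  simp_rw [h]
  rw [integral_add ((hA.integrable i j).const_mul _) (integrable_const _), integral_const_mul,
    hA.integral_eq hij]
  simp
  nlinarith [sq_nonneg (Θ i j)]

variable {K : ℕ} {p : ℝ}

/-- The noise in one diagonal block exceeds its typical size only with exponentially small
probability. The summand `p` accounts for the diagonal, where `A` vanishes but `Θ` does not. -/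
lemma IsRandomAdjacency.measureReal_norm_diagBlock_sub_le (hA : IsRandomAdjacency P Θ A)
    (hΘ0 : ∀ i j, 0 ≤ Θ i j) (hΘp : ∀ i j, Θ i j ≤ p) (hΘs : ∀ i j, Θ i j = Θ j i)
    (hp0 : 0 ≤ p) (hp : p ≤ 1) (c : Fin n → Fin K) (k : Fin K) (j : ℕ)
    (hj : communitySize c k * p ≤ (2 : ℝ) ^ j) :
    P.real {ω | noiseConst * √((2 : ℝ) ^ j) + p < ‖diagBlock c (A ω) k - diagBlock c Θ k‖} ≤
      communitySize c k * (1 / 4) ^ (2 ^ j) := by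
  let Z : {e : {i // c i = k} × {i // c i = k} // e.1 < e.2} → Ω → ℝ := fun e ω =>
    A ω e.1.1 e.1.2 - Θ e.1.1 e.1.2
  have hind : iIndepFun Z P := by
    have h1 := hA.indep.precomp (g := fun e : {e : {i // c i = k} × {i // c i = k} // e.1 < e.2} =>
      (⟨(e.1.1.1, e.1.2.1), e.2⟩ : {p : Fin n × Fin n // p.1 < p.2})) (by
        rintro ⟨⟨⟨a, _⟩, ⟨b, _⟩⟩, _⟩ ⟨⟨⟨a', _⟩, ⟨b', _⟩⟩, _⟩ h
        simp only [Subtype.mk.injEq, Prod.mk.injEq] at h ⊢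
        exact h)
    exact h1.comp (fun e x => x - Θ e.1.1 e.1.2) fun e => measurable_id.sub_const _
  have hm : ∀ e, Measurable (Z e) := fun e => (hA.measurable _ _).sub_const _
  have hB : ∀ e ω, |Z e ω| ≤ 1 := fun e ω => by
    have h0 := hΘ0 e.1.1 e.1.2
    have h1 := (hΘp e.1.1 e.1.2).trans hp
    rw [abs_le]
    rcases hA.zero_or_one ω e.1.1 e.1.2 with h | h <;> simp only [Z, h] <;>
      constructor <;> linarith
  have hmean : ∀ e, ∫ ω, Z e ω ∂P = 0 := fun e => by
    rw [integral_sub (hA.integrable _ _) (integrable_const _), hA.integral_eq e.2]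
    simp
  have hvar : ∀ e, ∫ ω, Z e ω ^ 2 ∂P ≤ p := fun e =>
    (hA.integral_sub_sq_le e.2).trans (hΘp _ _)
  have hmain := measureReal_norm_symMatrix_ge_le hm hB hind hmean hp0 hp hvar j hj
  refine le_trans (measureReal_mono fun ω hω => ?_) hmain
  have hdecomp : diagBlock c (A ω) k - diagBlock c Θ k =
      symMatrix (fun e => Z e ω) - Matrix.diagonal fun i : {i // c i = k} => Θ i i := by
    ext i i'
    rw [Matrix.sub_apply, Matrix.sub_apply]
    rcases lt_trichotomy i i' with h | rfl | h
    · rw [symMatrix_apply_of_lt _ h, Matrix.diagonal_apply_ne _ h.ne, sub_zero]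
      rfl
    · rw [symMatrix_apply_self, Matrix.diagonal_apply_eq]
      simp [diagBlock, hA.diag]
    · rw [symMatrix_comm, symMatrix_apply_of_lt _ h, Matrix.diagonal_apply_ne _ h.ne', sub_zero]
      simp only [diagBlock, Matrix.submatrix_apply, Z]
      rw [hA.symm ω i i', hΘs i i']
  have hdiag : ‖(Matrix.diagonal fun i : {i // c i = k} => Θ i i : Matrix _ _ ℝ)‖ ≤ p := by
    rw [Matrix.l2_opNorm_diagonal]
    refine (pi_norm_le_iff_of_nonneg hp0).2 fun i => ?_
    rw [Real.norm_eq_abs, abs_of_nonneg (hΘ0 _ _)]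
    exact hΘp _ _
  have h1 := norm_sub_le (symMatrix fun e => Z e ω)
    (Matrix.diagonal fun i : {i // c i = k} => Θ i i : Matrix _ _ ℝ)
  rw [← hdecomp] at h1
  have h2 : noiseConst * √((2 : ℝ) ^ j) + p < ‖diagBlock c (A ω) k - diagBlock c Θ k‖ := hω
  change noiseConst * √((2 : ℝ) ^ j) ≤ ‖symMatrix fun e => Z e ω‖
  linarith

/-- The size of the noise, relative to the square root of the expected degree of a block, for
labellings balanced with constant `C`. -/
noncomputable def balancedNoiseConst (C : ℝ) : ℝ := noiseConst * √(2 * C) + 1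

lemma balancedNoiseConst_pos (C : ℝ) : 0 < balancedNoiseConst C :=
  add_pos_of_nonneg_of_pos (mul_nonneg noiseConst_pos.le (Real.sqrt_nonneg _)) one_pos

/-- Noise bound for a block of a balanced labelling with `T` classes, in the regime in which the
expected degree `ρ² n / T` is at least `D ≥ 1`. -/
lemma IsRandomAdjacency.measureReal_noise_le (hA : IsRandomAdjacency P Θ A) {ρ C D : ℝ}
    (hρ0 : 0 < ρ) (hρ : ρ ≤ 1) (hC : 1 ≤ C) (hD : 1 ≤ D)
    (hΘ0 : ∀ i j, 0 ≤ Θ i j) (hΘp : ∀ i j, Θ i j ≤ ρ ^ 2) (hΘs : ∀ i j, Θ i j = Θ j i)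
    (hK : 0 < K) (hDK : D ≤ ρ ^ 2 * (n / K)) (c : Fin n → Fin K) (hc : IsBalanced C c)
    (k : Fin K) :
    P.real {ω | balancedNoiseConst C * (ρ * √((n : ℝ) / K)) <
      ‖diagBlock c (A ω) k - diagBlock c Θ k‖} ≤ n * Real.exp (-D) := by
  have hKR : (0 : ℝ) < K := by exact_mod_cast hK
  set x : ℝ := ρ ^ 2 * (n / K) with hx
  have hx1 : 1 ≤ C * x := one_le_mul_of_one_le_of_one_le hC (hD.trans hDK)
  obtain ⟨m, hm1, hm2⟩ := exists_nat_pow_near hx1 (one_lt_two : (1 : ℝ) < 2)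
  have hp : ρ ^ 2 ≤ 1 := pow_le_one₀ hρ0.le hρ
  have hsize : communitySize c k * ρ ^ 2 ≤ (2 : ℝ) ^ (m + 1) := by
    refine le_trans ?_ hm2.le
    calc communitySize c k * ρ ^ 2 ≤ C * n / K * ρ ^ 2 :=
          mul_le_mul_of_nonneg_right (hc k).2 (sq_nonneg _)
      _ = C * x := by rw [hx]; ring
  have hmain := hA.measureReal_norm_diagBlock_sub_le hΘ0 hΘp hΘs (sq_nonneg ρ) hp c k (m + 1) hsize
  have hsqrt : ρ * √((n : ℝ) / K) = √x := by
    rw [hx, Real.sqrt_mul (sq_nonneg _), Real.sqrt_sq hρ0.le]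
  have hthr : noiseConst * √((2 : ℝ) ^ (m + 1)) + ρ ^ 2 ≤
      balancedNoiseConst C * (ρ * √((n : ℝ) / K)) := by
    have h1 : √((2 : ℝ) ^ (m + 1)) ≤ √(2 * C) * √x := by
      rw [← Real.sqrt_mul (by positivity)]
      refine Real.sqrt_le_sqrt ?_
      rw [pow_succ]
      linarith
    have h2 : 1 ≤ √x := Real.one_le_sqrt.2 (hD.trans hDK)
    have h3 := mul_le_mul_of_nonneg_left h1 noiseConst_pos.le
    rw [hsqrt, balancedNoiseConst]
    linarith
  refine (measureReal_mono fun ω hω => lt_of_le_of_lt hthr hω).trans (hmain.trans ?_)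
  have hcard : (communitySize c k : ℝ) ≤ n := by
    have : communitySize c k ≤ n := (Fintype.card_subtype_le _).trans_eq (Fintype.card_fin n)
    exact_mod_cast this
  have hexp : (1 / 4 : ℝ) ^ (2 ^ (m + 1)) ≤ Real.exp (-D) := by
    have h1 : (1 / 4 : ℝ) ≤ Real.exp (-1) := by
      rw [Real.exp_neg, one_div, inv_le_inv₀ (by norm_num) (Real.exp_pos _)]
      linarith [Real.exp_one_lt_d9]
    calc (1 / 4 : ℝ) ^ (2 ^ (m + 1)) ≤ Real.exp (-1) ^ (2 ^ (m + 1)) :=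
          pow_le_pow_left₀ (by norm_num) h1 _
      _ = Real.exp (-(2 : ℝ) ^ (m + 1)) := by
          rw [← Real.exp_nat_mul]
          push_cast
          ring_nf
      _ ≤ Real.exp (-D) := by
          refine Real.exp_le_exp.2 (neg_le_neg ?_)
          have : x ≤ C * x := le_mul_of_one_le_left (zero_le_one.trans (hD.trans hDK)) hC
          linarith
  gcongr

/-- Simultaneous noise bound for all blocks of all given labellings with at most `Kmax` classes. -/
lemma IsRandomAdjacency.measureReal_uniform_noise_le (hA : IsRandomAdjacency P Θ A)
    {ρ C D : ℝ} (hρ0 : 0 < ρ) (hρ : ρ ≤ 1) (hC : 1 ≤ C) (hD : 1 ≤ D)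
    (hΘ0 : ∀ i j, 0 ≤ Θ i j) (hΘp : ∀ i j, Θ i j ≤ ρ ^ 2) (hΘs : ∀ i j, Θ i j = Θ j i)
    {Kmax : ℕ} (hDK : ∀ T : ℕ+, (T : ℕ) ≤ Kmax → D ≤ ρ ^ 2 * ((n : ℝ) / (T : ℕ)))
    (c : ∀ T : ℕ+, Fin n → Fin T) (hc : ∀ T : ℕ+, (T : ℕ) ≤ Kmax → IsBalanced C (c T)) :
    P.real {ω | ∃ T : ℕ+, (T : ℕ) ≤ Kmax ∧ ∃ k,
      balancedNoiseConst C * (ρ * √((n : ℝ) / (T : ℕ))) <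
        ‖diagBlock (c T) (A ω) k - diagBlock (c T) Θ k‖} ≤
      Kmax * (Kmax * (n * Real.exp (-D))) := by
  have hle : ∀ t : Fin Kmax, (Nat.succPNat t : ℕ) ≤ Kmax := fun t => t.2
  calc P.real _ ≤ P.real (⋃ t : Fin Kmax, ⋃ k : Fin (Nat.succPNat t),
        {ω | balancedNoiseConst C * (ρ * √((n : ℝ) / (Nat.succPNat t : ℕ))) <
          ‖diagBlock (c (Nat.succPNat t)) (A ω) k - diagBlock (c (Nat.succPNat t)) Θ k‖}) := by
        refine measureReal_mono ?_
        rintro ω ⟨T, hT, k, hk⟩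
        obtain ⟨t, rfl⟩ : ∃ t, T = Nat.succPNat t := ⟨_, (PNat.succPNat_natPred T).symm⟩
        exact Set.mem_iUnion.2 ⟨⟨t, hT⟩, Set.mem_iUnion.2 ⟨k, hk⟩⟩
    _ ≤ ∑ t : Fin Kmax, ∑ k : Fin (Nat.succPNat t), n * Real.exp (-D) :=
        (measureReal_iUnion_fintype_le _).trans (Finset.sum_le_sum fun t _ =>
          (measureReal_iUnion_fintype_le _).trans (Finset.sum_le_sum fun k _ =>
            hA.measureReal_noise_le hρ0 hρ hC hD hΘ0 hΘp hΘs (PNat.pos _) (hDK _ (hle t)) _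
              (hc _ (hle t)) k))
    _ ≤ ∑ _t : Fin Kmax, (Kmax : ℝ) * (n * Real.exp (-D)) := by
        refine Finset.sum_le_sum fun t _ => ?_
        rw [Finset.sum_const, nsmul_eq_mul, Finset.card_univ, Fintype.card_fin]
        have : ((Nat.succPNat t : ℕ) : ℝ) ≤ Kmax := by exact_mod_cast hle t
        gcongr
    _ = _ := by simp

end BlockNoise

lemma edgeProb_bounds {n K : ℕ} {ρ : ℝ} {L₀ : Matrix (Fin n) (Fin K) ℝ}
    (hL : ∀ i k, 0 < L₀ i k ∧ L₀ i k < 1) (c : Fin n → Fin K) (i j : Fin n) :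
    0 ≤ edgeProb (ρ • L₀) c i j ∧ edgeProb (ρ • L₀) c i j ≤ ρ ^ 2 ∧
      edgeProb (ρ • L₀) c i j = edgeProb (ρ • L₀) c j i := by
  have h1 := hL i (c j)
  have h2 := hL j (c i)
  have h3 : edgeProb (ρ • L₀) c i j = ρ ^ 2 * (L₀ i (c j) * L₀ j (c i)) := by
    simp [edgeProb]
    ring
  refine ⟨?_, ?_, by simp [edgeProb, mul_comm]⟩
  · rw [h3]
    exact mul_nonneg (sq_nonneg _) (mul_nonneg h1.1.le h2.1.le)
  · rw [h3]
    exact mul_le_of_le_one_right (sq_nonneg _) (mul_le_one₀ h1.2.le h2.1.le h2.2.le)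

end PABM

/-! ### Selection of the number of communities -/

theorem mainTheorem5 (C₁ C₂ c₀ γ : ℝ) (hC₁ : 1 ≤ C₁) (hC₂ : 4 * C₁ ≤ C₂) (hc₀ : 0 < c₀)
    (hγ : 0 < γ) :
    ∃ a b C' : ℝ, 0 < a ∧ 0 < b ∧ 0 < C' ∧
      ∀ (K : ℕ → ℕ) (ρ : ℕ → ℝ) (L₀ : ∀ n, Matrix (Fin n) (Fin (K n)) ℝ)
        (cstar : ∀ n, Fin n → Fin (K n)) (Θ : ∀ n, Matrix (Fin n) (Fin n) ℝ),
        (∀ n, 0 < ρ n ∧ ρ n ≤ 1) →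
        (∀ n i k, 0 < L₀ n i k ∧ L₀ n i k < 1) →
        (∀ n, Θ n = PABM.edgeProb (ρ n • L₀ n) (cstar n)) →
        (∀ n, PABM.IsBalanced C₁ (cstar n)) →
        (∀ᶠ n : ℕ in atTop, ∀ Kt : ℕ+, (Kt : ℕ) < K n → ∀ c : Fin n → Fin Kt,
          PABM.IsOptimal C₂ (Θ n) c →
            c₀ * ((n : ℝ) * ρ n ^ 2 / ((Kt : ℕ) * √(Real.log n))) ≤ PABM.f c (Θ n)) →
        (∀ (n : ℕ) (Kt : ℕ+), K n ≤ Kt → ∀ c : Fin n → Fin Kt,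
          PABM.IsOptimal C₂ (Θ n) c → PABM.f c (Θ n) = 0) ∧
        (∀ Kmax : ℕ → ℕ,
          (∀ᶠ n : ℕ in atTop, (Kmax n : ℝ) ≤ (n : ℝ) ^ (1 - γ)) →
          ((fun n : ℕ => Real.log n ^ 2) =o[atTop]
            fun n : ℕ => ρ n ^ 2 * ((n : ℝ) / Kmax n)) →
          ∀ c : ∀ (n : ℕ) (Kt : ℕ+), Fin n → Fin Kt,
          (∀ᶠ n : ℕ in atTop, ∀ Kt : ℕ+, (Kt : ℕ) ≤ Kmax n →
            PABM.IsOptimal C₂ (Θ n) (c n Kt)) →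
          ∀ (Ω : ℕ → Type*) [∀ n, MeasurableSpace (Ω n)] (P : ∀ n, Measure (Ω n))
            [∀ n, IsProbabilityMeasure (P n)] (A : ∀ n, Ω n → Matrix (Fin n) (Fin n) ℝ),
          (∀ n, PABM.IsRandomAdjacency (P n) (Θ n) (A n)) →
          ∀ᶠ n : ℕ in atTop,
            1 - (n : ℝ) ^ (-C') ≤ (P n).real {ω | ∀ Kt : ℕ+, (Kt : ℕ) ≤ Kmax n →
              (K n ≤ Kt →
                PABM.f (c n Kt) (A n ω) ≤ b * (ρ n * √((n : ℝ) / (Kt : ℕ)))) ∧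
              ((Kt : ℕ) < K n →
                a * ((n : ℝ) * ρ n ^ 2 / ((Kt : ℕ) * √(Real.log n)))
                    ≤ PABM.f (c n Kt) (A n ω) ∧
                PABM.f (c n Kt) (A n ω) ≤ b * ((n : ℝ) * ρ n ^ 2 / (Kt : ℕ)))}) := by

  set b₀ := PABM.balancedNoiseConst C₂ with hb₀
  have hb₀0 : 0 < b₀ := PABM.balancedNoiseConst_pos C₂
  have hC₂1 : 1 ≤ C₂ := by linarith
  refine ⟨c₀ / 2, C₂ + b₀, 1, by positivity, by positivity, one_pos, ?_⟩
  intro K ρ L₀ cstar Θ hρ hL hΘ hbal hlow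
  have hI : ∀ (n : ℕ) (Kt : ℕ+), K n ≤ Kt → ∀ c : Fin n → Fin Kt,
      PABM.IsOptimal C₂ (Θ n) c → PABM.f c (Θ n) = 0 := fun n Kt hK c hc => by
    rw [hΘ n] at hc ⊢
    exact hc.f_eq_zero hC₁ hC₂ Kt.pos hK (hbal n)
  refine ⟨hI, ?_⟩
  intro Kmax hKmax hlog c hopt Ω _ P _ A hA
  have hlogn : Tendsto (fun n : ℕ => Real.log n) atTop atTop :=
    Real.tendsto_log_atTop.comp tendsto_natCast_atTop_atTop
  filter_upwards [hlow, hKmax, hlog.bound one_pos, hopt, hlogn.eventually_ge_atTop 4,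
    hlogn.eventually_ge_atTop ((2 * b₀ / c₀) ^ 2), eventually_ge_atTop 1]
    with n hlow hKmax hlog hopt hℓ4 hℓb hn
  obtain ⟨hρ0, hρ1⟩ := hρ n
  have hnR : (1 : ℝ) ≤ n := by exact_mod_cast hn
  set ℓ := Real.log n with hℓ
  have hbd : ∀ i j, 0 ≤ Θ n i j ∧ Θ n i j ≤ ρ n ^ 2 ∧ Θ n i j = Θ n j i := fun i j => by
    rw [hΘ n]
    exact PABM.edgeProb_bounds (hL n) (cstar n) i j
  have hKn : (Kmax n : ℝ) ≤ n := hKmax.trans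
    ((Real.rpow_le_rpow_of_exponent_le hnR (by linarith)).trans_eq (Real.rpow_one _))
  have hD : ℓ ^ 2 ≤ ρ n ^ 2 * ((n : ℝ) / Kmax n) := by
    rw [one_mul, Real.norm_of_nonneg (sq_nonneg _), Real.norm_of_nonneg (by positivity)] at hlog
    exact hlog
  have hDT : ∀ T : ℕ+, (T : ℕ) ≤ Kmax n → ℓ ^ 2 ≤ ρ n ^ 2 * ((n : ℝ) / (T : ℕ)) := fun T hT => by
    have h1 : ((T : ℕ) : ℝ) ≤ Kmax n := by exact_mod_cast hT
    have h2 : (0 : ℝ) < (T : ℕ) := by exact_mod_cast T.pos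
    refine hD.trans ?_
    gcongr
  have hprob := (hA n).measureReal_uniform_noise_le hρ0 hρ1 hC₂1 (D := ℓ ^ 2) (by nlinarith)
    (fun i j => (hbd i j).1) (fun i j => (hbd i j).2.1) (fun i j => (hbd i j).2.2) hDT (c n)
    (fun T hT => (hopt T hT).1)
  -- `n³ exp (-ℓ²) ≤ n⁻¹` because `ℓ ≥ 4`
  have hsmall : (Kmax n : ℝ) * (Kmax n * (n * Real.exp (-ℓ ^ 2))) ≤ (n : ℝ) ^ (-1 : ℝ) := by
    have hexp : (n : ℝ) = Real.exp ℓ := (Real.exp_log (by linarith)).symm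
    calc (Kmax n : ℝ) * (Kmax n * (n * Real.exp (-ℓ ^ 2)))
        ≤ n * (n * (n * Real.exp (-ℓ ^ 2))) := by gcongr
      _ = Real.exp (ℓ + (ℓ + (ℓ + -ℓ ^ 2))) := by
          rw [Real.exp_add, Real.exp_add, Real.exp_add, ← hexp]
      _ ≤ Real.exp (-ℓ) := Real.exp_le_exp.2 (by nlinarith)
      _ = (n : ℝ) ^ (-1 : ℝ) := by rw [Real.rpow_neg_one, Real.exp_neg, ← hexp]
  set bad : Set (Ω n) := _ with hbad
  change (P n).real bad ≤ _ at hprob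
  have hcompl : 1 - (P n).real bad ≤ (P n).real badᶜ := by
    have h := measureReal_union_le (μ := P n) bad badᶜ
    rw [Set.union_compl_self, probReal_univ] at h
    linarith
  refine le_trans (by linarith) (hcompl.trans (measureReal_mono fun ω hω Kt hKt => ?_))
  simp only [hbad, Set.mem_compl_iff, Set.mem_ofPred_eq, not_exists, not_and, not_lt] at hω
  -- everything is expressed through `s = √(ρ² n / Kt) ≥ ℓ`
  have hKt0 : (0 : ℝ) < (Kt : ℕ) := by exact_mod_cast Kt.pos
  obtain ⟨s, hs⟩ : ∃ s : ℝ, s = ρ n * √((n : ℝ) / (Kt : ℕ)) := ⟨_, rfl⟩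
  have hs0 : 0 ≤ s := hs ▸ by positivity
  have hs2 : s ^ 2 = ρ n ^ 2 * ((n : ℝ) / (Kt : ℕ)) := by
    rw [hs, mul_pow, Real.sq_sqrt (by positivity)]
  have hsq : (n : ℝ) * ρ n ^ 2 / (Kt : ℕ) = s ^ 2 := by rw [hs2]; ring
  have hsℓ : ℓ ≤ s := le_of_sq_le_sq (by rw [hs2]; exact hDT Kt hKt) hs0
  have hnoise := hω Kt hKt
  rw [← hs] at hnoise ⊢
  have hδ0 : 0 ≤ b₀ * s := by positivity
  obtain ⟨hlower, hupper⟩ := abs_le.1 (PABM.abs_f_sub_f_le (c n Kt) (A n ω) (Θ n) hδ0 hnoise)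
  refine ⟨fun hK => ?_, fun hK => ⟨?_, ?_⟩⟩
  · rw [hI n Kt hK _ (hopt Kt hKt)] at hupper
    have h1 : 0 ≤ C₂ * s := mul_nonneg (by linarith) hs0
    linarith
  · have h1 := hlow Kt hK _ (hopt Kt hKt)
    rw [← div_div, hsq] at h1 ⊢
    have hr0 : 0 < √ℓ := Real.sqrt_pos.2 (by linarith)
    have hr : 2 * b₀ / c₀ ≤ √ℓ := Real.le_sqrt_of_sq_le hℓb
    have h2 : b₀ * s ≤ c₀ / 2 * (s ^ 2 / √ℓ) := by
      rw [← mul_div_assoc, le_div_iff₀ hr0]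
      have h3 : b₀ * √ℓ ≤ c₀ / 2 * s := by
        rw [div_le_iff₀ hc₀] at hr
        have h4 : √ℓ * √ℓ = ℓ := Real.mul_self_sqrt (by linarith)
        nlinarith
      nlinarith
    linarith
  · have h1 := (hopt Kt hKt).1.f_le_of_entry_le (fun i j => (hbd i j).1) (fun i j => (hbd i j).2.1)
      (sq_nonneg (ρ n)) (by linarith)
    have h2 : C₂ * n / (Kt : ℕ) * ρ n ^ 2 = C₂ * s ^ 2 := by rw [hs2]; ring
    have h3 : s ≤ s ^ 2 := le_self_pow₀ (by linarith) two_ne_zero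
    have h4 := mul_le_mul_of_nonneg_left h3 hb₀0.le
    rw [h2] at h1
    rw [hsq]
    linarith
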